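/- All graphs are finite, simple and undirected. For a connected graph $G=(V,E)$ with $|V|\ge 2$, let $D=[d_G(x,y)]_{x,y\in V}$ be its distance matrix ($d_G$ is the graph distance), and define its quadratic embedding constant by $$\mathrm{QEC}(G)=\max\{\langle f,Df\rangle \;:\; f\in\mathbb{R}^V,\ \langle f,f\rangle=1,\ \langle \mathbf 1,f\rangle=0\},$$ where $\mathbf 1$ is the constant function $1$ and $\langle\cdot,\cdot\rangle$ is the canonical inner product. Let $K_n$ be the complete graph and $P_n$ the path on $n$ vertices. Let $K_m*K_n$ be the graph obtained from disjoint copies of $K_m$ and $K_n$ by identifying one vertex of $K_m$ with one vertex of $K_n$. For $n\ge s$, let $K_n*(K_{m_1},\dots,K_{m_s})$ be the graph obtained from $K_n$ by choosing $s$ distinct vertices $v_1,\dots,v_s$ of $K_n$ and, for each $i$, identifying $v_i$ with one vertex of a disjoint copy of $K_{m_i}$. **Proposition.** We have $\mathrm{QEC}(P_4)=-(2-\sqrt2)$. Moreover, a connected graph $G$ with at least two vertices satisfies $$\mathrm{QEC}(G)=\mathrm{QEC}(P_4)=-(2-\sqrt2)$$ if and only if, up to isomorphism, either $G=K_4*K_3$,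 or $G=K_n*(\underbrace{K_2,\dots,K_2}_{s\text{ times}})$ for some integers $n\ge s\ge2$. -/

import Mathlib

open scoped Matrix

namespace QEGraph

/-- The distance matrix `D = [d_G(x, y)]` of a graph, with real entries. -/
noncomputable def distMatrix {V : Type*} (G : SimpleGraph V) : Matrix V V ℝ :=
  Matrix.of fun x y => (G.dist x y : ℝ)

/-- The unit vectors `f ∈ C(V)` that are orthogonal to the constant function `1`. -/
def admissible (V : Type*) [Fintype V] : Set (V → ℝ) :=
  {f | f ⬝ᵥ f = 1 ∧ (1 : V → ℝ) ⬝ᵥ f = 0}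

/-- The quadratic embedding constant: the maximum of `⟨f, D f⟩` over all `f` with `⟨f, f⟩ = 1`
and `⟨1, f⟩ = 0`. The supremum is attained as soon as there are two vertices,
see `isGreatest_qec`. -/
noncomputable def qec {V : Type*} [Fintype V] (G : SimpleGraph V) : ℝ :=
  sSup ((fun f : V → ℝ => f ⬝ᵥ (distMatrix G *ᵥ f)) '' admissible V)

theorem isCompact_admissible (V : Type*) [Fintype V] : IsCompact (admissible V) := by
  have hcl : IsClosed (admissible V) := by
    have h1 : Continuous fun f : V → ℝ => f ⬝ᵥ f := by
      unfold dotProduct; fun_prop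
    have h2 : Continuous fun f : V → ℝ => (1 : V → ℝ) ⬝ᵥ f := by
      unfold dotProduct; fun_prop
    exact (isClosed_eq h1 continuous_const).inter (isClosed_eq h2 continuous_const)
  refine (isCompact_closedBall (0 : V → ℝ) 1).of_isClosed_subset hcl ?_
  rintro f ⟨hf, -⟩
  rw [mem_closedBall_zero_iff, pi_norm_le_iff_of_nonneg zero_le_one]
  intro v
  rw [Real.norm_eq_abs, ← sq_le_one_iff_abs_le_one]
  have h := Finset.single_le_sum (f := fun v => f v * f v)
    (fun i _ => mul_self_nonneg (f i)) (Finset.mem_univ v)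
  have h' : ∑ v, f v * f v = 1 := hf
  rw [h'] at h
  nlinarith [h]

theorem admissible_nonempty (V : Type*) [Fintype V] [Nontrivial V] :
    (admissible V).Nonempty := by
  classical
  obtain ⟨a, b, hab⟩ := exists_pair_ne V
  have h2 : (√2 : ℝ) * √2 = 2 := Real.mul_self_sqrt (by norm_num)
  have h0 : (√2 : ℝ) ≠ 0 := by positivity
  refine ⟨Pi.single a (1 / √2) - Pi.single b (1 / √2), ?_, ?_⟩
  · simp only [sub_dotProduct, dotProduct_sub, single_dotProduct, Pi.single_eq_same,
      Pi.single_eq_of_ne hab, Pi.single_eq_of_ne hab.symm]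
    field_simp
    nlinarith
  · simp

/-- On a graph with at least two vertices the supremum in `qec` is a maximum. -/
theorem isGreatest_qec {V : Type*} [Fintype V] [Nontrivial V] (G : SimpleGraph V) :
    IsGreatest ((fun f : V → ℝ => f ⬝ᵥ (distMatrix G *ᵥ f)) '' admissible V) (qec G) := by
  refine IsCompact.isGreatest_sSup ?_ ((admissible_nonempty V).image _)
  refine (isCompact_admissible V).image ?_
  unfold dotProduct Matrix.mulVec dotProduct
  fun_prop

/-- Adjacency in the graph obtained from `G` by forming, for each `i`, the star product with the
rooted graph `(H i, o i)` at the vertex `r i` of `G`. -/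
def starAdj {V ι : Type*} {W : ι → Type*} (G : SimpleGraph V) (r : ι → V)
    (H : ∀ i, SimpleGraph (W i)) (o : ∀ i, W i) :
    V ⊕ (Σ i, {w : W i // w ≠ o i}) → V ⊕ (Σ i, {w : W i // w ≠ o i}) → Prop
  | .inl a, .inl b => G.Adj a b
  | .inl a, .inr ⟨i, w⟩ => a = r i ∧ (H i).Adj (o i) w
  | .inr ⟨i, w⟩, .inl a => a = r i ∧ (H i).Adj (o i) w
  | .inr x, .inr y => ∃ (i : ι) (w w' : {w : W i // w ≠ o i}),
      x = ⟨i, w⟩ ∧ y = ⟨i, w'⟩ ∧ (H i).Adj w w'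

/-- Star product: disjoint copies of `G` and of the `H i`, where the root `o i` of `H i` is
identified with the vertex `r i` of `G` (so only the other vertices of `H i` are added). -/
def starProduct {V ι : Type*} {W : ι → Type*} (G : SimpleGraph V) (r : ι → V)
    (H : ∀ i, SimpleGraph (W i)) (o : ∀ i, W i) :
    SimpleGraph (V ⊕ (Σ i, {w : W i // w ≠ o i})) where
  Adj := starAdj G r H o
  symm := ⟨by
    rintro (a | ⟨i, w⟩) (b | ⟨j, w'⟩) h
    · exact SimpleGraph.Adj.symm h
    · exact h
    · exact h
    · obtain ⟨k, u, u', hx, hy, h⟩ := h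
      exact ⟨k, u', u, hy, hx, SimpleGraph.Adj.symm h⟩⟩
  loopless := ⟨by
    rintro (a | ⟨i, w⟩) h
    · exact G.loopless.irrefl a h
    · obtain ⟨k, u, u', hx, hy, h⟩ := h
      have huu : u = u' := by
        have := hx.symm.trans hy
        simpa using this
      subst huu
      exact (H k).loopless.irrefl _ h⟩

/-- `K_m * K_n`: the star product of two complete graphs at a vertex of each. As complete graphs
are symmetric under all permutations, the choice of these vertices does not matter. -/
def completeStarTwo (m n : ℕ) [NeZero m] [NeZero n] :
    SimpleGraph (Fin m ⊕ (Σ _ : Unit, {w : Fin n // w ≠ 0})) :=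
  starProduct (SimpleGraph.completeGraph (Fin m)) (fun _ => 0)
    (fun _ => SimpleGraph.completeGraph (Fin n)) (fun _ => 0)

/-- `K_n * (K_{m 0}, …, K_{m (s-1)})` for `s ≤ n`: a star product of `K_n` with the `K_{m i}` at
`s` distinct vertices of `K_n`. -/
def completeStar (n : ℕ) {s : ℕ} (h : s ≤ n) (m : Fin s → ℕ) [∀ i, NeZero (m i)] :
    SimpleGraph (Fin n ⊕ (Σ i : Fin s, {w : Fin (m i) // w ≠ 0})) :=
  starProduct (SimpleGraph.completeGraph (Fin n)) (Fin.castLE h)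
    (fun i => SimpleGraph.completeGraph (Fin (m i))) (fun _ => 0)

end QEGraph

/-!
Write `c = -(2 - √2)`. Then `qec G = c` means that `⟨f, D f⟩ ≤ c ⟨f, f⟩` for all `f` of sum zero
(`QecLE G c`), with equality for some `f ≠ 0` (`qec_eq_iff`). Testing the bound on vectors supported
at a few vertices restricts the shape of `G`, without any general theory of block graphs.

*Some distance is at least three.* Then `G` contains an isometric `P₄` with vertices `a, b, c, d`.
On it the value is attained by `(-1, 1 + √2, -(1 + √2), 1)`. As a maximizer, this vector satisfies
the eigenvalue equation up to a constant on all of `G` (`sum_mul_dist_sub_eq`), and irrationality of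
`√2` turns this into `d(x, a) = d(x, d)` and `d(x, b) = d(x, c)` for every further vertex `x`
(`IsGeodesic.dist_eq_dist`). So the ends of every isometric `P₄` are pendant vertices, and `G` is a
complete graph with at most one pendant vertex at each of its vertices
(`IsGeodesic.exists_isPendantClique`). Conversely, in such a graph `⟨f, D f⟩` decomposes over the
pendant edges, and the bound reduces to the smallest eigenvalue `2 - √2` of `!![1, 1; 1, 3]`
(`IsPendantClique.qecLE`). The path `P₄` itself is a case of this.

*All distances are at most two.* The bound forbids `K₄` minus an edge, `C₄`, `C₅` and the claw as
induced subgraphs, so `G` consists of two cliques that share one vertex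
(`QecLE.exists_isCliquePair`). If their other vertices form parts `A` and `C`, then
`⟨f, D f⟩ = -⟨f, f⟩ + 2 S_A S_C` with `S` the sums of `f` over the parts, and a discriminant
computation gives `qec G = c` exactly if `(|A| - 1) (|C| - 1) = 2`, which is the case of `K₄ * K₃`
(`IsCliquePair.card_mul_card_of_qec_eq`, `IsCliquePair.qec_eq_of_card`).
-/

namespace QEGraph

/-! ### The quadratic form of the distance matrix -/

section Mass

variable {V ι : Type*} [Fintype ι] (v : ι → V) (w : ι → ℝ)

/-- The function with mass `w i` at the vertex `v i`. -/
noncomputable def pointMass (x : V) : ℝ :=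
  open scoped Classical in ∑ i, if v i = x then w i else 0

variable {v} in
theorem pointMass_apply (hv : Function.Injective v) (i : ι) : pointMass v w (v i) = w i := by
  classical
  simp [pointMass, hv.eq_iff]

theorem pointMass_apply_of_notMem {x : V} (hx : ∀ i, v i ≠ x) : pointMass v w x = 0 := by
  simp [pointMass, hx]

end Mass

section Form

variable {V : Type*} [Fintype V] (G : SimpleGraph V)

/-- The bilinear form `⟨f, D g⟩` of the distance matrix, written as a double sum. -/
noncomputable def distForm (f g : V → ℝ) : ℝ :=
  ∑ x, ∑ y, f x * g y * (G.dist x y : ℝ)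

theorem dotProduct_distMatrix_mulVec (f g : V → ℝ) :
    f ⬝ᵥ (distMatrix G *ᵥ g) = distForm G f g := by
  simp only [distForm, dotProduct, Matrix.mulVec, distMatrix, Matrix.of_apply, Finset.mul_sum]
  exact Finset.sum_congr rfl fun x _ => Finset.sum_congr rfl fun y _ => by ring

theorem distForm_comm (f g : V → ℝ) : distForm G f g = distForm G g f := by
  unfold distForm
  rw [Finset.sum_comm]
  refine Finset.sum_congr rfl fun x _ => Finset.sum_congr rfl fun y _ => ?_
  rw [G.dist_comm]
  ring

theorem distForm_eq_sum_mul (f g : V → ℝ) :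
    distForm G f g = ∑ x, f x * ∑ y, g y * (G.dist x y : ℝ) := by
  simp only [distForm, Finset.mul_sum, mul_assoc]

theorem distForm_smul_smul (t : ℝ) (f : V → ℝ) :
    distForm G (fun x => t * f x) (fun x => t * f x) = t ^ 2 * distForm G f f := by
  simp only [distForm, Finset.mul_sum]
  exact Finset.sum_congr rfl fun x _ => Finset.sum_congr rfl fun y _ => by ring

theorem distForm_smul_add_self (t : ℝ) (g e : V → ℝ) :
    distForm G (fun x => t * g x + e x) (fun x => t * g x + e x) =
      t ^ 2 * distForm G g g + 2 * t * distForm G e g + distForm G e e := by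
  have h : 2 * t * distForm G e g = t * distForm G e g + t * distForm G g e := by
    rw [distForm_comm G g e]; ring
  rw [h]
  simp only [distForm, Finset.mul_sum, ← Finset.sum_add_distrib]
  exact Finset.sum_congr rfl fun x _ => Finset.sum_congr rfl fun y _ => by ring

/-- The real number `c` is an upper bound for the quotient `⟨f, D f⟩ / ⟨f, f⟩` over the nonzero
vectors `f` of sum zero. -/
def QecLE (c : ℝ) : Prop :=
  ∀ f : V → ℝ, ∑ x, f x = 0 → distForm G f f ≤ c * ∑ x, f x ^ 2

/-- Scaled form of the definition of `qec`: the value `c` is a bound for the quotient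
`⟨f, D f⟩ / ⟨f, f⟩` over all nonzero `f` of sum zero, and it is attained. -/
theorem qec_eq_iff [Nontrivial V] (c : ℝ) :
    qec G = c ↔ QecLE G c ∧
      ∃ f : V → ℝ, ∑ x, f x = 0 ∧ f ≠ 0 ∧ distForm G f f = c * ∑ x, f x ^ 2 := by
  have hpos : ∀ f : V → ℝ, f ≠ 0 → 0 < ∑ x, f x ^ 2 := by
    intro f hf
    obtain ⟨v, hv⟩ := Function.ne_iff.mp hf
    exact Finset.sum_pos' (fun x _ => sq_nonneg _) ⟨v, Finset.mem_univ v, by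
      have : f v ≠ 0 := hv
      positivity⟩
  have hadm : ∀ f : V → ℝ, f ∈ admissible V ↔ ∑ x, f x ^ 2 = 1 ∧ ∑ x, f x = 0 := by
    intro f
    simp [admissible, dotProduct, pow_two]
  -- every nonzero vector of sum zero is a multiple of an admissible one
  have hscale : ∀ f : V → ℝ, ∑ x, f x = 0 → f ≠ 0 → ∃ g ∈ admissible V,
      distForm G f f = distForm G g g * ∑ x, f x ^ 2 := by
    intro f hf hf0
    have hp := hpos f hf0
    set N := ∑ x, f x ^ 2 with hN
    have hs : √N ^ 2 = N := Real.sq_sqrt hp.le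
    have hs0 : √N ≠ 0 := (Real.sqrt_pos.mpr hp).ne'
    refine ⟨fun x => (√N)⁻¹ * f x, (hadm _).mpr ⟨?_, ?_⟩, ?_⟩
    · simp only [mul_pow, ← Finset.mul_sum, ← hN, inv_pow, hs]
      exact inv_mul_cancel₀ hp.ne'
    · rw [← Finset.mul_sum, hf, mul_zero]
    · rw [distForm_smul_smul, inv_pow, hs]
      field_simp
  have hgr := isGreatest_qec G
  simp only [dotProduct_distMatrix_mulVec] at hgr
  constructor
  · rintro rfl
    obtain ⟨⟨f, hf, hfq⟩, hub⟩ := hgr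
    have hf' := (hadm f).mp hf
    constructor
    · intro f hf
      by_cases hf0 : f = 0
      · simp [hf0, distForm]
      obtain ⟨g, hg, hfg⟩ := hscale f hf hf0
      rw [hfg]
      exact mul_le_mul_of_nonneg_right (hub ⟨g, hg, rfl⟩) (hpos f hf0).le
    · refine ⟨f, hf'.2, ?_, by rw [hf'.1, mul_one]; exact hfq⟩
      rintro rfl
      simp at hf'
  · rintro ⟨hle, f, hf, hf0, heq⟩
    refine hgr.unique ⟨?_, ?_⟩
    · obtain ⟨g, hg, hfg⟩ := hscale f hf hf0
      refine ⟨g, hg, ?_⟩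
      exact mul_right_cancel₀ (hpos f hf0).ne' (hfg.symm.trans heq)
    · rintro _ ⟨g, hg, rfl⟩
      have hg' := (hadm g).mp hg
      simpa [hg'.1] using hle g hg'.2

variable {G}

/-- A maximizer of the quotient `⟨f, D f⟩ / ⟨f, f⟩` on the vectors of sum zero is an eigenvector
of `D` there: `D g - c g` is a constant function. -/
theorem sum_mul_dist_sub_eq {c : ℝ}
    (hle : QecLE G c)
    {g : V → ℝ} (hg : ∑ x, g x = 0) (hgc : distForm G g g = c * ∑ x, g x ^ 2) (u v : V) :
    ∑ y, g y * (G.dist u y : ℝ) - c * g u = ∑ y, g y * (G.dist v y : ℝ) - c * g v := by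
  classical
  set e : V → ℝ := Pi.single u 1 - Pi.single v 1 with he
  have hsum : ∀ φ : V → ℝ, ∑ x, e x * φ x = φ u - φ v := by
    intro φ
    simp [he, sub_mul, Pi.single_apply]
  have he0 : ∑ x, e x = 0 := by simpa using hsum 1
  have h1 : distForm G e g =
      ∑ y, g y * (G.dist u y : ℝ) - ∑ y, g y * (G.dist v y : ℝ) := by
    rw [distForm_eq_sum_mul, hsum]
  have h2 := hsum g
  have key : ∀ t : ℝ, 2 * t * (distForm G e g - c * (g u - g v)) +
      (distForm G e e - c * ∑ x, e x ^ 2) ≤ 0 := by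
    intro t
    have h3 := hle (fun x => t * g x + e x) (by
      rw [Finset.sum_add_distrib, ← Finset.mul_sum, hg, he0]; ring)
    have h4 : ∑ x, (t * g x + e x) ^ 2 =
        t ^ 2 * ∑ x, g x ^ 2 + 2 * t * ∑ x, e x * g x + ∑ x, e x ^ 2 := by
      simp only [Finset.mul_sum, ← Finset.sum_add_distrib]
      exact Finset.sum_congr rfl fun x _ => by ring
    rw [distForm_smul_add_self, h4, hgc, h2] at h3
    linarith
  -- an affine function of `t` that is bounded above has slope zero
  set B := distForm G e g - c * (g u - g v) with hB
  set K := distForm G e e - c * ∑ x, e x ^ 2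
  have hB0 : B = 0 := by
    by_contra hne
    have := key ((1 - K) / (2 * B))
    have h5 : 2 * ((1 - K) / (2 * B)) * B = 1 - K := by field_simp
    rw [h5] at this
    linarith
  rw [hB, h1] at hB0
  linarith

section PointMass

variable {ι : Type*} [Fintype ι] (v : ι → V) (w : ι → ℝ)

theorem sum_pointMass_mul (φ : V → ℝ) : ∑ x, pointMass v w x * φ x = ∑ i, w i * φ (v i) := by
  classical
  simp only [pointMass, Finset.sum_mul]
  rw [Finset.sum_comm]
  refine Finset.sum_congr rfl fun i _ => ?_
  simp [ite_mul]

theorem sum_pointMass : ∑ x, pointMass v w x = ∑ i, w i := by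
  simpa using sum_pointMass_mul v w 1

variable {v} in
theorem sum_pointMass_sq (hv : Function.Injective v) :
    ∑ x, pointMass v w x ^ 2 = ∑ i, w i ^ 2 := by
  simp only [pow_two, sum_pointMass_mul, pointMass_apply w hv]

variable (G) in
theorem distForm_pointMass :
    distForm G (pointMass v w) (pointMass v w) =
      ∑ i, ∑ j, w i * w j * (G.dist (v i) (v j) : ℝ) := by
  rw [distForm_eq_sum_mul, sum_pointMass_mul]
  simp only [sum_pointMass_mul, Finset.mul_sum, mul_assoc]

end PointMass

end Form

/-! ### Two cliques with one common vertex -/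

section CliquePair

variable {V : Type*}

/-- `G` consists of the two cliques `A ∪ {b}` and `C ∪ {b}`, which share exactly the vertex `b`
and have no edges between `A` and `C`. The parts `A` and `C` may be empty. -/
structure IsCliquePair (G : SimpleGraph V) (b : V) (A C : Finset V) : Prop where
  notMem_left : b ∉ A
  notMem_right : b ∉ C
  disjoint : Disjoint A C
  cover : ∀ x, x = b ∨ x ∈ A ∨ x ∈ C
  adj_iff : ∀ x y, G.Adj x y ↔ x ≠ y ∧ ¬ (x ∈ A ∧ y ∈ C) ∧ ¬ (x ∈ C ∧ y ∈ A)

theorem _root_.SimpleGraph.dist_eq_two_of_adj {G : SimpleGraph V} {x y z : V} (hxy : x ≠ y)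
    (h : ¬ G.Adj x y) (hxz : G.Adj x z) (hzy : G.Adj z y) : G.dist x y = 2 := by
  have hw := SimpleGraph.dist_le (SimpleGraph.Walk.cons hxz (SimpleGraph.Walk.cons hzy .nil))
  have h0 := (hxz.reachable.trans hzy.reachable).pos_dist_of_ne hxy
  have h1 : G.dist x y ≠ 1 := fun h' => h (SimpleGraph.dist_eq_one_iff_adj.mp h')
  simp only [SimpleGraph.Walk.length_cons, SimpleGraph.Walk.length_nil] at hw
  omega

theorem one_lt_sqrt_two : (1 : ℝ) < √2 := by
  rw [Real.lt_sqrt] <;> norm_num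

/-- If `S ^ 2 ≤ a P` and `T ^ 2 ≤ c R` with `a c < a + c + 1`, then the quadratic form
`S ^ 2 + T ^ 2 + P + R - 2 √2 S T` only vanishes for `P = R = 0`. -/
theorem eq_zero_of_defect_eq_zero {a c S T P R : ℝ} (ha : 0 ≤ a) (hP : 0 ≤ P) (hR : 0 ≤ R)
    (hS : S ^ 2 ≤ a * P) (hT : T ^ 2 ≤ c * R) (hac : a * c < a + c + 1)
    (h0 : S ^ 2 + T ^ 2 + P + R - 2 * √2 * S * T = 0) : P = 0 ∧ R = 0 := by
  have h2 : (√2 : ℝ) ^ 2 = 2 := Real.sq_sqrt (by norm_num)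
  rcases hP.eq_or_lt with hP0 | hP0
  · have hS0 : S = 0 := pow_eq_zero_iff two_ne_zero |>.mp
      (le_antisymm (by rw [← hP0] at hS; simpa using hS) (sq_nonneg S))
    rw [hS0, ← hP0] at h0
    exact ⟨hP0.symm, by nlinarith [sq_nonneg T]⟩
  rcases hR.eq_or_lt with hR0 | hR0
  · have hT0 : T = 0 := pow_eq_zero_iff two_ne_zero |>.mp
      (le_antisymm (by rw [← hR0] at hT; simpa using hT) (sq_nonneg T))
    rw [hT0, ← hR0] at h0
    exact ⟨by nlinarith [sq_nonneg S], hR0.symm⟩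
  exfalso
  obtain ⟨s, hs⟩ : ∃ s, S ^ 2 = s * P := ⟨S ^ 2 / P, by field_simp⟩
  obtain ⟨t, ht⟩ : ∃ t, T ^ 2 = t * R := ⟨T ^ 2 / R, by field_simp⟩
  have hsa : s ≤ a := le_of_mul_le_mul_right (hs ▸ hS) hP0
  have htc : t ≤ c := le_of_mul_le_mul_right (ht ▸ hT) hR0
  have hs0 : 0 ≤ s := nonneg_of_mul_nonneg_left (hs ▸ sq_nonneg S) hP0
  have ht0 : 0 ≤ t := nonneg_of_mul_nonneg_left (ht ▸ sq_nonneg T) hR0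
  -- a bilinear function on the rectangle `[0, a] × [0, c]`, positive at its corners
  have hpos : 0 < 1 + s + t - s * t := by
    rcases le_total t 1 with h | h
    · nlinarith [mul_nonneg hs0 (sub_nonneg.mpr h)]
    · have h3 := mul_nonneg (sub_nonneg.mpr hsa) (sub_nonneg.mpr h)
      rcases le_total a 1 with h' | h'
      · nlinarith [mul_nonneg ht0 (sub_nonneg.mpr h')]
      · nlinarith [mul_nonneg (sub_nonneg.mpr htc) (sub_nonneg.mpr h')]
  have h4 : 0 < (1 + s + t - s * t) * (P * R) := by positivity
  have h5 : (S ^ 2 + P + (T ^ 2 + R)) ^ 2 = 8 * S ^ 2 * T ^ 2 := by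
    have : S ^ 2 + P + (T ^ 2 + R) = 2 * √2 * S * T := by linarith
    rw [this]
    linear_combination 4 * S ^ 2 * T ^ 2 * h2
  rw [hs, ht] at h5
  nlinarith [sq_nonneg (s * P + P - (t * R + R))]

namespace IsCliquePair

variable {G : SimpleGraph V} {b : V} {A C : Finset V}

theorem swap (h : IsCliquePair G b A C) : IsCliquePair G b C A where
  notMem_left := h.notMem_right
  notMem_right := h.notMem_left
  disjoint := h.disjoint.symm
  cover x := by have := h.cover x; tauto
  adj_iff x y := by rw [h.adj_iff]; tauto

theorem dist_eq [DecidableEq V] (h : IsCliquePair G b A C) (x y : V) :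
    (G.dist x y : ℝ) = 1 - (if x = y then 1 else 0) +
      (if x ∈ A then 1 else 0) * (if y ∈ C then 1 else 0) +
      (if x ∈ C then 1 else 0) * (if y ∈ A then 1 else 0) := by
  have hd : ∀ z, z ∈ A → z ∉ C := fun z hz => Finset.disjoint_left.mp h.disjoint hz
  have hbA := h.notMem_left
  have hbC := h.notMem_right
  by_cases hxy : x = y
  · subst hxy
    by_cases hA : x ∈ A
    · simp [hA, hd x hA]
    · simp [hA]
  by_cases hadj : G.Adj x y
  · have h' := (h.adj_iff x y).mp hadj
    rw [SimpleGraph.dist_eq_one_iff_adj.mpr hadj]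
    by_cases hA : x ∈ A
    · have : y ∉ C := fun hy => h'.2.1 ⟨hA, hy⟩
      simp [hxy, hA, hd x hA, this]
    · by_cases hC : x ∈ C
      · have : y ∉ A := fun hy => h'.2.2 ⟨hC, hy⟩
        simp [hxy, hA, hC, this]
      · simp [hxy, hA, hC]
  · have hcross : (x ∈ A ∧ y ∈ C) ∨ (x ∈ C ∧ y ∈ A) := by
      by_contra hn
      push Not at hn
      exact hadj ((h.adj_iff x y).mpr ⟨hxy, by tauto, by tauto⟩)
    have hxb : x ≠ b := by rintro rfl; tauto
    have hyb : y ≠ b := by rintro rfl; tauto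
    rw [SimpleGraph.dist_eq_two_of_adj (z := b) hxy hadj
      ((h.adj_iff x b).mpr ⟨hxb, by tauto, by tauto⟩)
      ((h.adj_iff b y).mpr ⟨hyb.symm, by tauto, by tauto⟩)]
    rcases hcross with ⟨hx, hy⟩ | ⟨hx, hy⟩
    · simp [hxy, hx, hy, hd x hx]; norm_num
    · have hx' : x ∉ A := fun h' => hd x h' hx
      simp [hxy, hx, hy, hx']; norm_num

/-- The vector of sum zero that is constant on each of the two parts. -/
noncomputable def blockVector (b : V) (A C : Finset V) (p q : ℝ) (x : V) : ℝ :=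
  open scoped Classical in
  if x = b then -(A.card * p + C.card * q) else if x ∈ A then p else q

theorem blockVector_of_mem_left (h : IsCliquePair G b A C) (p q : ℝ) {x : V} (hx : x ∈ A) :
    blockVector b A C p q x = p := by
  have : x ≠ b := by rintro rfl; exact h.notMem_left hx
  simp [blockVector, this, hx]

theorem blockVector_of_mem_right (h : IsCliquePair G b A C) (p q : ℝ) {x : V} (hx : x ∈ C) :
    blockVector b A C p q x = q := by
  have : x ≠ b := by rintro rfl; exact h.notMem_right hx
  simp [blockVector, this, Finset.disjoint_right.mp h.disjoint hx]

variable [Fintype V]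

theorem sum_univ (h : IsCliquePair G b A C) (φ : V → ℝ) :
    ∑ x, φ x = φ b + ∑ x ∈ A, φ x + ∑ x ∈ C, φ x := by
  classical
  have hu : (Finset.univ : Finset V) = insert b (A ∪ C) := by
    ext x
    simpa using h.cover x
  have hb : b ∉ A ∪ C := by
    simp [h.notMem_left, h.notMem_right]
  rw [hu, Finset.sum_insert hb, Finset.sum_union h.disjoint, add_assoc]

/-- On vectors of sum zero only the cross term between the two parts survives in `⟨f, D f⟩`. -/
theorem distForm_self (h : IsCliquePair G b A C) {f : V → ℝ} (hf : ∑ x, f x = 0) :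
    distForm G f f = - ∑ x, f x ^ 2 + 2 * (∑ x ∈ A, f x) * ∑ x ∈ C, f x := by
  classical
  have hmem : ∀ (φ : V → ℝ) (B : Finset V), ∑ y, φ y * (if y ∈ B then 1 else 0) = ∑ y ∈ B, φ y :=
    fun φ B => by simp [mul_ite, Finset.sum_ite_mem]
  have hin : ∀ x, ∑ y, f y * (G.dist x y : ℝ) = - f x +
      (if x ∈ A then 1 else 0) * (∑ y ∈ C, f y) + (if x ∈ C then 1 else 0) * ∑ y ∈ A, f y := by
    intro x
    rw [← hmem f C, ← hmem f A, Finset.mul_sum, Finset.mul_sum]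
    have h1 : - f x = ∑ y, f y * (1 - if x = y then 1 else 0) := by
      simp [mul_sub, hf]
    rw [h1, ← Finset.sum_add_distrib, ← Finset.sum_add_distrib]
    refine Finset.sum_congr rfl fun y _ => ?_
    rw [h.dist_eq]
    ring
  rw [distForm_eq_sum_mul]
  have h2 : ∀ x, f x * ∑ y, f y * (G.dist x y : ℝ) = - f x ^ 2 +
      (f x * (if x ∈ A then 1 else 0)) * (∑ y ∈ C, f y) +
      (f x * (if x ∈ C then 1 else 0)) * ∑ y ∈ A, f y := by
    intro x
    rw [hin]
    ring
  simp only [h2, Finset.sum_add_distrib, ← Finset.sum_mul, hmem, Finset.sum_neg_distrib]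
  ring

/-- The defect form: for `S` the sums and `Q` the sums of squares of `f` over the two parts,
`(-(2 - √2)) ⟨f, f⟩ - ⟨f, D f⟩ = (√2 - 1) (S_A ^ 2 + S_C ^ 2 + Q_A + Q_C - 2 √2 S_A S_C)`. -/
theorem defect_eq (h : IsCliquePair G b A C) {f : V → ℝ} (hf : ∑ x, f x = 0) :
    -(2 - √2) * ∑ x, f x ^ 2 - distForm G f f = (√2 - 1) *
      ((∑ x ∈ A, f x) ^ 2 + (∑ x ∈ C, f x) ^ 2 + ∑ x ∈ A, f x ^ 2 + ∑ x ∈ C, f x ^ 2 -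
        2 * √2 * (∑ x ∈ A, f x) * ∑ x ∈ C, f x) := by
  have h2 : (√2 : ℝ) ^ 2 = 2 := Real.sq_sqrt (by norm_num)
  rw [h.distForm_self hf, h.sum_univ fun x => f x ^ 2]
  rw [h.sum_univ] at hf
  have hb : f b = -(∑ x ∈ A, f x + ∑ x ∈ C, f x) := by linarith
  rw [hb]
  linear_combination (2 * (∑ x ∈ A, f x) * ∑ x ∈ C, f x) * h2

theorem sum_blockVector (h : IsCliquePair G b A C) (p q : ℝ) :
    ∑ x, blockVector b A C p q x = 0 := by
  rw [h.sum_univ, Finset.sum_congr rfl fun x hx => h.blockVector_of_mem_left p q hx,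
    Finset.sum_congr rfl fun x hx => h.blockVector_of_mem_right p q hx]
  simp [blockVector]

theorem defect_blockVector (h : IsCliquePair G b A C) (p q : ℝ) :
    -(2 - √2) * ∑ x, blockVector b A C p q x ^ 2 -
        distForm G (blockVector b A C p q) (blockVector b A C p q) =
      (√2 - 1) * ((A.card * p) ^ 2 + (C.card * q) ^ 2 + A.card * p ^ 2 + C.card * q ^ 2 -
        2 * √2 * (A.card * p) * (C.card * q)) := by
  have hl : ∀ φ : ℝ → ℝ, ∑ x ∈ A, φ (blockVector b A C p q x) = A.card * φ p := fun φ => by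
    rw [Finset.sum_congr rfl fun x hx => by rw [h.blockVector_of_mem_left p q hx]]
    simp
  have hr : ∀ φ : ℝ → ℝ, ∑ x ∈ C, φ (blockVector b A C p q x) = C.card * φ q := fun φ => by
    rw [Finset.sum_congr rfl fun x hx => by rw [h.blockVector_of_mem_right p q hx]]
    simp
  rw [h.defect_eq (h.sum_blockVector p q), hl fun t => t, hr fun t => t, hl fun t => t ^ 2,
    hr fun t => t ^ 2]

/-- `K₄ * K₃` attains the value: by Cauchy–Schwarz `S_A ^ 2 ≤ 3 Q_A` and `S_C ^ 2 ≤ 2 Q_C`, so the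
defect form is at least `(2 √2 S_A - 3 S_C) ^ 2 / 6`. -/
theorem qec_eq_of_card [Nontrivial V] (h : IsCliquePair G b A C) (hA : A.card = 3)
    (hC : C.card = 2) : qec G = -(2 - √2) := by
  have h2 : (√2 : ℝ) ^ 2 = 2 := Real.sq_sqrt (by norm_num)
  have h1 := one_lt_sqrt_two
  rw [qec_eq_iff]
  constructor
  · intro f hf
    have hd := h.defect_eq hf
    have hsA : (∑ x ∈ A, f x) ^ 2 ≤ 3 * ∑ x ∈ A, f x ^ 2 := by
      have := sq_sum_le_card_mul_sum_sq (s := A) (f := f)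
      rw [hA] at this
      exact_mod_cast this
    have hsC : (∑ x ∈ C, f x) ^ 2 ≤ 2 * ∑ x ∈ C, f x ^ 2 := by
      have := sq_sum_le_card_mul_sum_sq (s := C) (f := f)
      rw [hC] at this
      exact_mod_cast this
    set S := ∑ x ∈ A, f x
    set T := ∑ x ∈ C, f x
    have hsq : (2 * √2 * S - 3 * T) ^ 2 = 8 * S ^ 2 + 9 * T ^ 2 - 12 * √2 * S * T := by
      linear_combination 4 * S ^ 2 * h2
    have h0 := sq_nonneg (2 * √2 * S - 3 * T)
    have : 0 ≤ -(2 - √2) * ∑ x, f x ^ 2 - distForm G f f := by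
      rw [hd]
      exact mul_nonneg (by linarith) (by linarith)
    linarith
  · -- here `S_A = 9` and `S_C = 6 √2`, so that `2 √2 S_A = 3 S_C`
    refine ⟨blockVector b A C 3 (3 * √2), h.sum_blockVector _ _, fun h0 => ?_, ?_⟩
    · obtain ⟨x, hx⟩ : A.Nonempty := Finset.card_pos.mp (by omega)
      have := h.blockVector_of_mem_left 3 (3 * √2) hx
      rw [h0] at this
      norm_num at this
    · have hd := h.defect_blockVector 3 (3 * √2)
      rw [hA, hC] at hd
      push_cast at hd
      have : (3 * 3 : ℝ) ^ 2 + (2 * (3 * √2)) ^ 2 + 3 * 3 ^ 2 + 2 * (3 * √2) ^ 2 -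
          2 * √2 * (3 * 3) * (2 * (3 * √2)) = 0 := by linear_combination -54 * h2
      rw [this, mul_zero] at hd
      linarith

/-- The value `-(2 - √2)` forces `(|A| - 1) (|C| - 1) = 2`: a smaller product makes the defect form
positive definite, a larger one makes it indefinite on the vectors constant on both parts. -/
theorem card_mul_card_of_qec_eq [Nontrivial V] (h : IsCliquePair G b A C)
    (hq : qec G = -(2 - √2)) : A.card * C.card = A.card + C.card + 1 := by
  have h2 : (√2 : ℝ) ^ 2 = 2 := Real.sq_sqrt (by norm_num)
  have h1 := one_lt_sqrt_two
  obtain ⟨hle, f, hf, hf0, hfe⟩ := (qec_eq_iff G _).mp hq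
  set a : ℝ := (A.card : ℝ) with ha
  set c : ℝ := (C.card : ℝ) with hc
  have ha0 : 0 ≤ a := Nat.cast_nonneg _
  have hc0 : 0 ≤ c := Nat.cast_nonneg _
  have hup : a * c ≤ a + c + 1 := by
    by_contra! hlt
    -- the vector minimizing the defect form among those constant on both parts
    have hd := h.defect_blockVector (c + 1) (√2 * a)
    have hl := hle _ (h.sum_blockVector (c + 1) (√2 * a))
    rw [← ha, ← hc] at hd
    have hapos : 0 < a := by
      rcases ha0.eq_or_lt with h0 | h0
      · rw [← h0] at hlt; linarith
      · exact h0
    have hneg : (a * (c + 1)) ^ 2 + (c * (√2 * a)) ^ 2 + a * (c + 1) ^ 2 + c * (√2 * a) ^ 2 -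
        2 * √2 * (a * (c + 1)) * (c * (√2 * a)) =
          a * (c + 1) * (a + c + 1 - a * c) := by
      linear_combination (c ^ 2 * a ^ 2 + c * a ^ 2 - 2 * a * (c + 1) * c * a) * h2
    rw [hneg] at hd
    have : (√2 - 1) * (a * (c + 1) * (a + c + 1 - a * c)) < 0 :=
      mul_neg_of_pos_of_neg (by linarith)
        (mul_neg_of_pos_of_neg (by positivity) (by linarith))
    linarith
  have hlow : a + c + 1 ≤ a * c := by
    by_contra! hlt
    apply hf0
    have hd := h.defect_eq hf
    rw [hfe, sub_self] at hd
    have hd' := (mul_eq_zero.mp hd.symm).resolve_left (by linarith)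
    have hsA : (∑ x ∈ A, f x) ^ 2 ≤ a * ∑ x ∈ A, f x ^ 2 := sq_sum_le_card_mul_sum_sq
    have hsC : (∑ x ∈ C, f x) ^ 2 ≤ c * ∑ x ∈ C, f x ^ 2 := sq_sum_le_card_mul_sum_sq
    have hqA : 0 ≤ ∑ x ∈ A, f x ^ 2 := Finset.sum_nonneg fun _ _ => sq_nonneg _
    have hqC : 0 ≤ ∑ x ∈ C, f x ^ 2 := Finset.sum_nonneg fun _ _ => sq_nonneg _
    have hzero : ∑ x ∈ A, f x ^ 2 = 0 ∧ ∑ x ∈ C, f x ^ 2 = 0 := by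
      exact eq_zero_of_defect_eq_zero ha0 hqA hqC hsA hsC hlt (by linarith)
    have hA0 := (Finset.sum_eq_zero_iff_of_nonneg fun _ _ => sq_nonneg _).mp hzero.1
    have hC0 := (Finset.sum_eq_zero_iff_of_nonneg fun _ _ => sq_nonneg _).mp hzero.2
    have hA1 : ∀ x ∈ A, f x = 0 := fun x hx => pow_eq_zero_iff two_ne_zero |>.mp (hA0 x hx)
    have hC1 : ∀ x ∈ C, f x = 0 := fun x hx => pow_eq_zero_iff two_ne_zero |>.mp (hC0 x hx)
    rw [h.sum_univ, Finset.sum_eq_zero hA1, Finset.sum_eq_zero hC1] at hf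
    funext x
    rcases h.cover x with rfl | hx | hx
    · simpa using hf
    · exact hA1 x hx
    · exact hC1 x hx
  have := le_antisymm hup hlow
  rw [ha, hc] at this
  exact_mod_cast this

end IsCliquePair

end CliquePair

/-! ### Geodesics of length three -/

section Geodesic

variable {V : Type*} {G : SimpleGraph V}

/-- The four vertices `v 0, …, v 3` span an isometric copy of the path `P₄`. -/
def IsGeodesic (G : SimpleGraph V) (v : Fin 4 → V) : Prop :=
  ∀ i j : Fin 4, i ≤ j → G.dist (v i) (v j) = (j : ℕ) - i

theorem isGeodesic_of_dist {a b c d : V} (hab : G.dist a b = 1) (hac : G.dist a c = 2)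
    (had : G.dist a d = 3) (hbc : G.dist b c = 1) (hbd : G.dist b d = 2) (hcd : G.dist c d = 1) :
    IsGeodesic G ![a, b, c, d] := by
  intro i j hij
  fin_cases i <;> fin_cases j <;> simp_all

/-- The eigenvector of the distance matrix of `P₄` for the eigenvalue `-(2 - √2)`. -/
noncomputable def pathVector : Fin 4 → ℝ := ![-1, 1 + √2, -(1 + √2), 1]

theorem sum_pathVector : ∑ i, pathVector i = 0 := by
  simp [pathVector, Fin.sum_univ_succ]

namespace IsGeodesic

variable {v : Fin 4 → V}

theorem injective (h : IsGeodesic G v) : Function.Injective v := by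
  have hlt : ∀ i j : Fin 4, i < j → v i ≠ v j := by
    intro i j hij he
    have := h i j hij.le
    rw [he, SimpleGraph.dist_self] at this
    have : (i : ℕ) < j := hij
    omega
  intro i j hij
  rcases lt_trichotomy i j with h' | h' | h'
  · exact absurd hij (hlt i j h')
  · exact h'
  · exact absurd hij.symm (hlt j i h')

theorem sum_pathVector_mul_dist (h : IsGeodesic G v) (i : Fin 4) :
    ∑ j, pathVector j * (G.dist (v i) (v j) : ℝ) = -(2 - √2) * pathVector i := by
  have h2 : (√2 : ℝ) ^ 2 = 2 := Real.sq_sqrt (by norm_num)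
  have h01 := h 0 1 (by decide)
  have h02 := h 0 2 (by decide)
  have h03 := h 0 3 (by decide)
  have h12 := h 1 2 (by decide)
  have h13 := h 1 3 (by decide)
  have h23 := h 2 3 (by decide)
  have h10 := h01
  have h20 := h02
  have h30 := h03
  have h21 := h12
  have h31 := h13
  have h32 := h23
  rw [G.dist_comm] at h10 h20 h30 h21 h31 h32
  fin_cases i <;>
    simp [Fin.sum_univ_four, pathVector, h01, h02, h03, h12, h13, h23, h10, h20, h30, h21, h31,
      h32] <;>
    linarith

theorem pointMass_ne_zero (h : IsGeodesic G v) : pointMass v pathVector ≠ 0 := by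
  intro h0
  have := pointMass_apply pathVector h.injective 3
  rw [h0] at this
  simp [pathVector] at this

variable [Fintype V]

theorem distForm_pathVector (h : IsGeodesic G v) :
    distForm G (pointMass v pathVector) (pointMass v pathVector) =
      -(2 - √2) * ∑ x, pointMass v pathVector x ^ 2 := by
  rw [distForm_pointMass, sum_pointMass_sq _ h.injective, Finset.mul_sum]
  refine Finset.sum_congr rfl fun i _ => ?_
  simp only [mul_assoc, ← Finset.mul_sum, h.sum_pathVector_mul_dist]
  ring

/-- If `-(2 - √2)` is an upper bound, then the eigenvector of an isometric `P₄` stays an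
eigenvector in `G`, and comparing coefficients of `1` and `√2` at a further vertex `x` shows that
`x` sees the path symmetrically. -/
theorem dist_eq_dist (h : IsGeodesic G v)
    (hle : QecLE G (-(2 - √2)))
    {x : V} (hx : ∀ i, v i ≠ x) :
    G.dist x (v 0) = G.dist x (v 3) ∧ G.dist x (v 1) = G.dist x (v 2) := by
  have hev := sum_mul_dist_sub_eq hle (g := pointMass v pathVector)
    (by rw [sum_pointMass, sum_pathVector]) h.distForm_pathVector x (v 0)
  rw [sum_pointMass_mul, sum_pointMass_mul, h.sum_pathVector_mul_dist,
    pointMass_apply _ h.injective, pointMass_apply_of_notMem _ _ hx, sub_self, mul_zero,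
    sub_zero] at hev
  simp only [Fin.sum_univ_four, pathVector, Matrix.cons_val] at hev
  have hirr : (√2 : ℝ) * (((G.dist x (v 1) : ℤ) - G.dist x (v 2) : ℤ) : ℝ) =
      (((G.dist x (v 0) : ℤ) - G.dist x (v 3) - G.dist x (v 1) + G.dist x (v 2) : ℤ) : ℝ) := by
    push_cast
    linarith
  have h12 : (G.dist x (v 1) : ℤ) - G.dist x (v 2) = 0 := by
    by_contra hne
    exact (irrational_sqrt_two.mul_intCast hne).ne_int _ hirr
  rw [h12, Int.cast_zero, mul_zero] at hirr
  have h03 : ((G.dist x (v 0) : ℤ) - G.dist x (v 3) - G.dist x (v 1) + G.dist x (v 2) : ℤ) = 0 := by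
    exact_mod_cast hirr.symm
  constructor <;> omega

end IsGeodesic

end Geodesic

/-! ### Complete graphs with pendant edges -/

section PendantClique

variable {V : Type*}

/-- A characterization of the distance from `x` by its local behaviour: it changes by at most one
along every edge, and every vertex other than `x` has a neighbour that is closer to `x`. -/
theorem _root_.SimpleGraph.dist_eq_of_descent {G : SimpleGraph V} {x : V} {δ : V → ℕ}
    (h0 : δ x = 0) (hlip : ∀ y z, G.Adj y z → δ z ≤ δ y + 1)
    (hdesc : ∀ y, y ≠ x → ∃ z, G.Adj z y ∧ δ z + 1 = δ y) (y : V) : G.dist x y = δ y := by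
  have hup : ∀ n y, δ y = n → ∃ w : G.Walk x y, w.length = n := by
    intro n
    induction n with
    | zero =>
      intro y hy
      have hyx : y = x := by
        by_contra hne
        obtain ⟨z, -, hz⟩ := hdesc y hne
        omega
      subst hyx
      exact ⟨.nil, rfl⟩
    | succ n ih =>
      intro y hy
      have hne : y ≠ x := by
        rintro rfl
        omega
      obtain ⟨z, hzy, hz⟩ := hdesc y hne
      obtain ⟨w, hw⟩ := ih z (by omega)
      exact ⟨w.concat hzy, by simp [hw]⟩
  have hlow : ∀ {u y : V} (w : G.Walk u y), δ y ≤ δ u + w.length := by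
    intro u y w
    induction w with
    | nil => simp
    | cons hadj w ih =>
      have := hlip _ _ hadj
      rw [SimpleGraph.Walk.length_cons]
      omega
  obtain ⟨w, hw⟩ := hup _ y rfl
  refine le_antisymm (hw ▸ SimpleGraph.dist_le w) ?_
  obtain ⟨w', hw'⟩ := w.reachable.exists_walk_length_eq_dist
  have := hlow w'
  omega

/-- `G` is a complete graph with at most one pendant vertex attached to each of its vertices. The
retraction `p` fixes the vertices of the complete graph and maps a pendant vertex to its
neighbour. -/
structure IsPendantClique (G : SimpleGraph V) (p : V → V) : Prop where
  idem : ∀ x, p (p x) = p x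
  fiber : ∀ x y, p x = p y → x = y ∨ p x = x ∨ p y = y
  adj_iff : ∀ x y, G.Adj x y ↔ x ≠ y ∧ (p x = p y ∨ p x = x ∧ p y = y)

namespace IsPendantClique

variable {G : SimpleGraph V} {p : V → V}

theorem dist_eq [DecidableEq V] (h : IsPendantClique G p) (x y : V) :
    G.dist x y = if x = y then 0 else
      (if p x = x then 0 else 1) + (if p y = y then 0 else 1) + (if p x = p y then 0 else 1) := by
  revert y
  refine SimpleGraph.dist_eq_of_descent (by simp) ?_ ?_
  · intro y z hyz
    have h1 := (h.adj_iff y z).mp hyz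
    have h2 := h.fiber y z
    grind
  · intro y hy
    by_cases hpy : p y = y
    · by_cases hxy : p x = p y
      · exact ⟨x, (h.adj_iff x y).mpr ⟨hy.symm, .inl hxy⟩, by grind⟩
      · refine ⟨p x, (h.adj_iff _ _).mpr ⟨?_, .inr ⟨h.idem x, hpy⟩⟩, ?_⟩
        · rwa [hpy] at hxy
        · have := h.idem x
          grind
    · have := h.idem y
      refine ⟨p y, (h.adj_iff _ _).mpr ⟨hpy, .inl this⟩, ?_⟩
      grind

theorem isGeodesic (h : IsPendantClique G p) {x y : V} (hx : p x ≠ x) (hy : p y ≠ y)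
    (hxy : x ≠ y) : IsGeodesic G ![x, p x, p y, y] := by
  classical
  have h1 := h.idem x
  have h2 := h.idem y
  have h3 := h.fiber x y
  apply isGeodesic_of_dist <;> rw [h.dist_eq] <;> grind

variable [Fintype V]

theorem distForm_self [DecidableEq V] (h : IsPendantClique G p) {f : V → ℝ}
    (hf : ∑ x, f x = 0) :
    distForm G f f = - (∑ v, (∑ x with p x = v, f x) ^ 2) -
      2 * ∑ x, (if p x = x then 0 else 1) * f x ^ 2 := by
  set η : V → ℝ := fun x => if p x = x then 0 else 1 with hη
  have hd : ∀ x y, (G.dist x y : ℝ) = η x + η y + 1 - (if p x = p y then 1 else 0) -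
      2 * η x * (if x = y then 1 else 0) := by
    intro x y
    rw [h.dist_eq, hη]
    by_cases hxy : x = y
    · subst hxy
      simp; split_ifs <;> norm_num
    · simp only [hxy, if_false]
      push_cast
      split_ifs <;> norm_num
  have hin : ∀ x, ∑ y, f y * (G.dist x y : ℝ) =
      ∑ y, f y * η y - ∑ y with p y = p x, f y - 2 * η x * f x := by
    intro x
    have h1 : ∀ y, f y * (G.dist x y : ℝ) = (η x + 1) * f y + f y * η y -
        (if p y = p x then f y else 0) - 2 * η x * (if x = y then f y else 0) := by
      intro y
      rw [hd]
      simp only [eq_comm (a := p x)]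
      split_ifs <;> ring
    simp only [h1, Finset.sum_add_distrib, Finset.sum_sub_distrib, ← Finset.mul_sum, hf,
      Finset.sum_filter, Finset.sum_ite_eq, Finset.mem_univ, if_true]
    ring
  rw [distForm_eq_sum_mul]
  have hsq : ∑ v, (∑ x with p x = v, f x) ^ 2 = ∑ x, f x * ∑ y with p y = p x, f y := by
    rw [← Finset.sum_fiberwise Finset.univ p fun x => f x * ∑ y with p y = p x, f y]
    refine Finset.sum_congr rfl fun v _ => ?_
    rw [pow_two, Finset.sum_mul]
    refine Finset.sum_congr rfl fun x hx => ?_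
    rw [(Finset.mem_filter.mp hx).2]
  have hη2 : ∑ x, f x * (2 * η x * f x) = 2 * ∑ x, η x * f x ^ 2 := by
    rw [Finset.mul_sum]
    exact Finset.sum_congr rfl fun x _ => by ring
  simp only [hin, mul_sub, Finset.sum_sub_distrib, ← Finset.sum_mul, hf]
  rw [hη2, hsq]
  ring

/-- Fibrewise this is positive semidefiniteness of `!![1, 1; 1, 3] - (2 - √2)`: the matrix
`!![1, 1; 1, 3]` has the eigenvalues `2 ± √2`. -/
theorem qecLE (h : IsPendantClique G p) : QecLE G (-(2 - √2)) := by
  intro f hf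
  let _ := Classical.decEq V
  have h2 : (√2 : ℝ) ^ 2 = 2 := Real.sq_sqrt (by norm_num)
  have h1 := one_lt_sqrt_two
  have hfib : ∀ v, 0 ≤ (∑ x with p x = v, f x) ^ 2 +
      ∑ x with p x = v, (2 * ((if p x = x then 0 else 1) * f x ^ 2) - (2 - √2) * f x ^ 2) := by
    intro v
    by_cases hv : p v = v
    · by_cases hq : ∃ q, q ≠ v ∧ p q = v
      · obtain ⟨q, hqv, hq⟩ := hq
        have hset : (Finset.univ.filter fun x => p x = v) = {v, q} := by
          ext x
          have := h.fiber x q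
          simp only [Finset.mem_filter, Finset.mem_univ, true_and, Finset.mem_insert,
            Finset.mem_singleton]
          grind
        have hpq : p q ≠ q := by rw [hq]; exact hqv.symm
        rw [hset, Finset.sum_pair hqv.symm, Finset.sum_pair hqv.symm, if_pos hv, if_neg hpq]
        have : (f v + f q) ^ 2 + (2 * (0 * f v ^ 2) - (2 - √2) * f v ^ 2 +
            (2 * (1 * f q ^ 2) - (2 - √2) * f q ^ 2)) =
            (√2 - 1) * (f v + (1 + √2) * f q) ^ 2 := by
          linear_combination (-(√2 + 1) * f q ^ 2 - 2 * f v * f q) * h2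
        rw [this]
        exact mul_nonneg (by linarith) (sq_nonneg _)
      · have hset : (Finset.univ.filter fun x => p x = v) = {v} := by
          ext x
          simp only [Finset.mem_filter, Finset.mem_univ, true_and, Finset.mem_singleton]
          push Not at hq
          have := hq x
          grind
        rw [hset, Finset.sum_singleton, Finset.sum_singleton, if_pos hv]
        nlinarith [sq_nonneg (f v)]
    · have hset : (Finset.univ.filter fun x => p x = v) = ∅ := by
        ext x
        simp only [Finset.mem_filter, Finset.mem_univ, true_and, Finset.notMem_empty, iff_false]
        rintro rfl
        exact hv (h.idem x)
      simp [hset]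
  have hsum := Finset.sum_nonneg fun v (_ : v ∈ Finset.univ) => hfib v
  rw [Finset.sum_add_distrib, Finset.sum_fiberwise, Finset.sum_sub_distrib, ← Finset.mul_sum,
    ← Finset.mul_sum] at hsum
  rw [h.distForm_self hf]
  linarith

theorem qec_eq [Nontrivial V] (h : IsPendantClique G p) {x y : V} (hx : p x ≠ x) (hy : p y ≠ y)
    (hxy : x ≠ y) : qec G = -(2 - √2) := by
  have hg := h.isGeodesic hx hy hxy
  exact (qec_eq_iff G _).mpr ⟨h.qecLE, _,
    by rw [sum_pointMass, sum_pathVector], hg.pointMass_ne_zero, hg.distForm_pathVector⟩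

end IsPendantClique

theorem isPendantClique_pathGraph_four :
    IsPendantClique (SimpleGraph.pathGraph 4) ![1, 1, 2, 2] where
  idem := by decide
  fiber := by decide
  adj_iff := by
    simp only [SimpleGraph.pathGraph_adj]
    decide

theorem qec_pathGraph_four : qec (SimpleGraph.pathGraph 4) = -(2 - √2) :=
  isPendantClique_pathGraph_four.qec_eq (x := 0) (y := 3) (by decide) (by decide) (by decide)

end PendantClique

section Classification

variable {V : Type*} {G : SimpleGraph V}

/-! ### Distances in connected graphs -/

theorem _root_.SimpleGraph.Connected.exists_adj_dist_succ (hG : G.Connected) {x y : V}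
    (hxy : x ≠ y) : ∃ z, G.Adj x z ∧ G.dist z y + 1 = G.dist x y := by
  obtain ⟨w, hw⟩ := hG.exists_walk_length_eq_dist x y
  cases w with
  | nil => exact absurd rfl hxy
  | @cons _ z _ hxz w =>
    refine ⟨z, hxz, ?_⟩
    have h1 := SimpleGraph.dist_le w
    have h2 := hG.dist_triangle (u := x) (v := z) (w := y)
    rw [SimpleGraph.dist_eq_one_iff_adj.mpr hxz] at h2
    rw [SimpleGraph.Walk.length_cons] at hw
    omega

theorem _root_.SimpleGraph.Connected.exists_dist_eq (hG : G.Connected) {x y : V} {n : ℕ}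
    (h : n ≤ G.dist x y) : ∃ z, G.dist z y = n := by
  obtain ⟨k, hk⟩ : ∃ k, G.dist x y = n + k := ⟨_, (Nat.add_sub_of_le h).symm⟩
  clear h
  induction k generalizing x with
  | zero => exact ⟨x, hk⟩
  | succ k ih =>
    have hne : x ≠ y := by
      rintro rfl
      rw [SimpleGraph.dist_self] at hk
      omega
    obtain ⟨z, -, hz⟩ := hG.exists_adj_dist_succ hne
    exact ih (x := z) (by omega)

theorem _root_.SimpleGraph.Connected.exists_adj_adj_of_dist_eq_two (hG : G.Connected) {x y : V}
    (h : G.dist x y = 2) : ∃ z, G.Adj x z ∧ G.Adj z y := by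
  have hne : x ≠ y := by
    rintro rfl
    simp at h
  obtain ⟨z, hxz, hz⟩ := hG.exists_adj_dist_succ hne
  exact ⟨z, hxz, SimpleGraph.dist_eq_one_iff_adj.mp (by omega)⟩

theorem _root_.SimpleGraph.Connected.exists_isGeodesic (hG : G.Connected) {x y : V}
    (h : 2 < G.dist x y) : ∃ a b c d, IsGeodesic G ![a, b, c, d] := by
  obtain ⟨a, had⟩ := hG.exists_dist_eq h
  have hne : a ≠ y := by
    rintro rfl
    simp at had
  obtain ⟨b, hab, hb⟩ := hG.exists_adj_dist_succ hne
  have hbd : G.dist b y = 2 := by omega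
  obtain ⟨c, hbc, hcd⟩ := hG.exists_adj_adj_of_dist_eq_two hbd
  have h1 := hG.dist_triangle (u := a) (v := b) (w := c)
  have h2 := hG.dist_triangle (u := a) (v := c) (w := y)
  rw [← SimpleGraph.dist_eq_one_iff_adj] at hab hbc hcd
  exact ⟨a, b, c, y, isGeodesic_of_dist hab (by omega) had hbc hbd hcd⟩

/-! ### Forbidden induced subgraphs -/

section Forbidden

variable [Fintype V]

theorem QecLE.four_points {c₀ : ℝ} (hle : QecLE G c₀) {a b c d : V} (hab : a ≠ b) (hac : a ≠ c)
    (had : a ≠ d) (hbc : b ≠ c) (hbd : b ≠ d) (hcd : c ≠ d) {p q r s : ℝ}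
    (h0 : p + q + r + s = 0) :
    2 * (p * q * G.dist a b + p * r * G.dist a c + p * s * G.dist a d + q * r * G.dist b c +
      q * s * G.dist b d + r * s * G.dist c d) ≤ c₀ * (p ^ 2 + q ^ 2 + r ^ 2 + s ^ 2) := by
  have hv : Function.Injective ![a, b, c, d] := by
    intro i j; fin_cases i <;> fin_cases j <;> simp_all [eq_comm]
  have h := hle (pointMass ![a, b, c, d] ![p, q, r, s])
    (by rw [sum_pointMass]; simpa [Fin.sum_univ_four] using h0)
  rw [distForm_pointMass, sum_pointMass_sq _ hv] at h
  simp only [Fin.sum_univ_four, Matrix.cons_val, SimpleGraph.dist_self] at h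
  rw [G.dist_comm (u := b) (v := a), G.dist_comm (u := c) (v := a),
    G.dist_comm (u := c) (v := b), G.dist_comm (u := d) (v := a),
    G.dist_comm (u := d) (v := b), G.dist_comm (u := d) (v := c)] at h
  push_cast at h
  linarith

theorem sqrt_two_lt : √2 < (3 / 2 : ℝ) := by
  rw [Real.sqrt_lt'] <;> norm_num

/-- `K₄` minus an edge is not an induced subgraph. -/
theorem QecLE.adj_of_adj (hle : QecLE G (-(2 - √2))) {b c x y : V} (hbc : G.Adj b c)
    (hbx : G.Adj b x) (hcx : G.Adj c x) (hby : G.Adj b y) (hcy : G.Adj c y) (hxy : x ≠ y) :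
    G.Adj x y := by
  by_contra hn
  have hd := SimpleGraph.dist_eq_two_of_adj hxy hn hbx.symm hby
  have h := hle.four_points (p := 1) (q := 1) (r := -1) (s := -1) hbc.ne hbx.ne hby.ne hcx.ne
    hcy.ne hxy (by norm_num)
  rw [← SimpleGraph.dist_eq_one_iff_adj] at hbc hbx hcx hby hcy
  rw [hbc, hbx, hcx, hby, hcy, hd] at h
  norm_num at h
  linarith [sqrt_two_lt]

/-- The cycle `C₄` is not an induced subgraph. -/
theorem QecLE.not_fourCycle (hle : QecLE G (-(2 - √2))) {a b c d : V} (hab : G.Adj a b)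
    (hbc : G.Adj b c) (hcd : G.Adj c d) (had : G.Adj a d) (hac : a ≠ c) (hbd : b ≠ d)
    (hnac : ¬ G.Adj a c) (hnbd : ¬ G.Adj b d) : False := by
  have hd1 := SimpleGraph.dist_eq_two_of_adj hac hnac hab hbc
  have hd2 := SimpleGraph.dist_eq_two_of_adj hbd hnbd hbc hcd
  have h := hle.four_points (p := 1) (q := -1) (r := 1) (s := -1) hab.ne hac had.ne hbc.ne
    hbd hcd.ne (by norm_num)
  rw [← SimpleGraph.dist_eq_one_iff_adj] at hab hbc hcd had
  rw [hab, hbc, hcd, had, hd1, hd2] at h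
  norm_num at h

/-- The claw `K_{1,3}` is not an induced subgraph. -/
theorem QecLE.not_claw (hle : QecLE G (-(2 - √2))) {m x y z : V} (hx : G.Adj m x)
    (hy : G.Adj m y) (hz : G.Adj m z) (hxy : x ≠ y) (hxz : x ≠ z) (hyz : y ≠ z)
    (hnxy : ¬ G.Adj x y) (hnxz : ¬ G.Adj x z) (hnyz : ¬ G.Adj y z) : False := by
  have hd1 := SimpleGraph.dist_eq_two_of_adj hxy hnxy hx.symm hy
  have hd2 := SimpleGraph.dist_eq_two_of_adj hxz hnxz hx.symm hz
  have hd3 := SimpleGraph.dist_eq_two_of_adj hyz hnyz hy.symm hz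
  have h := hle.four_points (p := 3) (q := -1) (r := -1) (s := -1) hx.ne hy.ne hz.ne hxy
    hxz hyz (by norm_num)
  rw [← SimpleGraph.dist_eq_one_iff_adj] at hx hy hz
  rw [hx, hy, hz, hd1, hd2, hd3] at h
  norm_num at h
  exact absurd h (by linarith [sqrt_two_lt])

/-- The cycle `C₅` is not an induced subgraph. -/
theorem QecLE.not_fiveCycle (hle : QecLE G (-(2 - √2))) {a b c d e : V} (hab : G.Adj a b)
    (hbc : G.Adj b c) (hcd : G.Adj c d) (hde : G.Adj d e) (hae : G.Adj a e)
    (hac : a ≠ c) (had : a ≠ d) (hbd : b ≠ d) (hbe : b ≠ e) (hce : c ≠ e)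
    (hnac : ¬ G.Adj a c) (hnad : ¬ G.Adj a d) (hnbd : ¬ G.Adj b d) (hnbe : ¬ G.Adj b e)
    (hnce : ¬ G.Adj c e) : False := by
  have hd1 := SimpleGraph.dist_eq_two_of_adj hac hnac hab hbc
  have hd2 := SimpleGraph.dist_eq_two_of_adj had hnad hae hde.symm
  have hd3 := SimpleGraph.dist_eq_two_of_adj hbd hnbd hbc hcd
  have hd4 := SimpleGraph.dist_eq_two_of_adj hbe hnbe hab.symm hae
  have hd5 := SimpleGraph.dist_eq_two_of_adj hce hnce hcd hde
  have hv : Function.Injective ![a, b, c, d, e] := by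
    intro i j
    fin_cases i <;> fin_cases j <;>
      simp [hab.ne, hab.ne.symm, hbc.ne, hbc.ne.symm, hcd.ne, hcd.ne.symm, hde.ne, hde.ne.symm,
        hae.ne, hae.ne.symm, hac, hac.symm, had, had.symm, hbd, hbd.symm, hbe, hbe.symm, hce,
        hce.symm]
  -- a rational approximation of an eigenvector for the smallest adjacency eigenvalue
  have h := hle (pointMass ![a, b, c, d, e] ![2, -2, 1, 1, -2])
    (by rw [sum_pointMass]; simp [Fin.sum_univ_five]; norm_num)
  rw [distForm_pointMass, sum_pointMass_sq _ hv] at h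
  simp only [Fin.sum_univ_five, Matrix.cons_val, SimpleGraph.dist_self] at h
  rw [G.dist_comm (u := b) (v := a), G.dist_comm (u := c) (v := a),
    G.dist_comm (u := c) (v := b), G.dist_comm (u := d) (v := a),
    G.dist_comm (u := d) (v := b), G.dist_comm (u := d) (v := c),
    G.dist_comm (u := e) (v := a), G.dist_comm (u := e) (v := b),
    G.dist_comm (u := e) (v := c), G.dist_comm (u := e) (v := d)] at h
  rw [← SimpleGraph.dist_eq_one_iff_adj] at hab hbc hcd hde hae
  rw [hab, hbc, hcd, hde, hae, hd1, hd2, hd3, hd4, hd5] at h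
  norm_num at h
  linarith [sqrt_two_lt]

end Forbidden

/-! ### Diameter at most two -/

section Diameter

variable [Fintype V]

/-- In diameter two an induced path `a, b, c` cannot be prolonged beyond `a`: a common neighbour of
the two ends would create an induced `C₅`, `C₄` or `K₄` minus an edge. -/
theorem QecLE.adj_of_diam_two (hle : QecLE G (-(2 - √2))) (hG : G.Connected)
    (hdiam : ∀ x y, G.dist x y ≤ 2) {a b c x : V} (hab : G.Adj a b) (hbc : G.Adj b c)
    (hac : a ≠ c) (hnac : ¬ G.Adj a c) (hxa : G.Adj x a) (hxb : x ≠ b) : G.Adj x b := by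
  by_contra hnxb
  have hxc : x ≠ c := by
    rintro rfl
    exact hnac hxa.symm
  by_cases hadj : G.Adj x c
  · exact hle.not_fourCycle hab hbc hadj.symm hxa.symm hac hxb.symm hnac
      fun h => hnxb h.symm
  obtain ⟨y, hxy, hyc⟩ : ∃ y, G.Adj x y ∧ G.Adj y c := by
    apply hG.exists_adj_adj_of_dist_eq_two
    have h0 := hG.pos_dist_of_ne hxc
    have h1 : G.dist x c ≠ 1 := fun h => hadj (SimpleGraph.dist_eq_one_iff_adj.mp h)
    have := hdiam x c
    omega
  have hya : y ≠ a := by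
    rintro rfl
    exact hnac hyc
  have hyb : y ≠ b := by
    rintro rfl
    exact hnxb hxy
  by_cases h1 : G.Adj y a <;> by_cases h2 : G.Adj y b
  · exact hnac (hle.adj_of_adj h2 h1 hab.symm hyc hbc hac)
  · exact hle.not_fourCycle hab hbc hyc.symm h1.symm hac hyb.symm hnac fun h => h2 h.symm
  · exact hle.not_fourCycle hxa hab h2.symm hxy hxb hya.symm hnxb fun h => h1 h.symm
  · exact hle.not_fiveCycle hxa hab hbc hyc.symm hxy hxb hxc hac hya.symm hyb.symm hnxb hadj
      hnac (fun h => h1 h.symm) fun h => h2 h.symm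

/-- In diameter two the middle vertex of an induced path is adjacent to all other vertices. -/
theorem QecLE.adj_middle (hle : QecLE G (-(2 - √2))) (hG : G.Connected)
    (hdiam : ∀ x y, G.dist x y ≤ 2) {a b c : V} (hab : G.Adj a b) (hbc : G.Adj b c)
    (hac : a ≠ c) (hnac : ¬ G.Adj a c) (x : V) (hxb : x ≠ b) : G.Adj x b := by
  by_contra hnxb
  have hxa : ¬ G.Adj x a := fun h => hnxb (hle.adj_of_diam_two hG hdiam hab hbc hac hnac h hxb)
  have hxc : ¬ G.Adj x c := fun h => hnxb (hle.adj_of_diam_two hG hdiam hbc.symm hab.symm hac.symm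
    (fun h' => hnac h'.symm) h hxb)
  obtain ⟨y, hxy, hyb⟩ : ∃ y, G.Adj x y ∧ G.Adj y b := by
    apply hG.exists_adj_adj_of_dist_eq_two
    have h0 := hG.pos_dist_of_ne hxb
    have h1 : G.dist x b ≠ 1 := fun h => hnxb (SimpleGraph.dist_eq_one_iff_adj.mp h)
    have := hdiam x b
    omega
  have hya : y ≠ a := by
    rintro rfl
    exact hxa hxy
  have hyc : y ≠ c := by
    rintro rfl
    exact hxc hxy
  by_cases h1 : G.Adj y a
  · by_cases h2 : G.Adj y c
    · exact hnac (hle.adj_of_adj hyb h1 hab.symm h2 hbc hac)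
    · exact hnxb (hle.adj_of_diam_two hG hdiam hyb hbc hyc h2 hxy hxb)
  · by_cases h2 : G.Adj y c
    · exact hnxb (hle.adj_of_diam_two hG hdiam hyb hab.symm hya h1 hxy hxb)
    · exact hle.not_claw hab.symm hbc hyb.symm hac hya.symm hyc.symm hnac (fun h => h1 h.symm)
        fun h => h2 h.symm

theorem QecLE.exists_isCliquePair (hle : QecLE G (-(2 - √2))) (hG : G.Connected)
    (hdiam : ∀ x y, G.dist x y ≤ 2) : ∃ b A C, IsCliquePair G b A C := by
  classical
  by_cases hcomplete : ∀ x y, x ≠ y → G.Adj x y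
  · obtain ⟨b⟩ := hG.nonempty
    refine ⟨b, Finset.univ.erase b, ∅, by simp, by simp, by simp, fun x => ?_, fun x y => ?_⟩
    · by_cases h : x = b <;> simp [h]
    · simpa using ⟨fun h => h.ne, hcomplete x y⟩
  push Not at hcomplete
  obtain ⟨a, c, hac, hnac⟩ := hcomplete
  obtain ⟨b, hab, hbc⟩ : ∃ b, G.Adj a b ∧ G.Adj b c := by
    apply hG.exists_adj_adj_of_dist_eq_two
    have h0 := hG.pos_dist_of_ne hac
    have h1 : G.dist a c ≠ 1 := fun h => hnac (SimpleGraph.dist_eq_one_iff_adj.mp h)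
    have := hdiam a c
    omega
  have hb : ∀ x, x ≠ b → G.Adj b x :=
    fun x hx => (hle.adj_middle hG hdiam hab hbc hac hnac x hx).symm
  have htrans : ∀ u v w, u ≠ b → v ≠ b → w ≠ b → u ≠ w → G.Adj u v → G.Adj v w → G.Adj u w :=
    fun u v w hu hv hw huw h1 h2 => hle.adj_of_adj (hb v hv) (hb u hu) h1.symm (hb w hw) h2 huw
  have hab' := hab.ne
  refine ⟨b, Finset.univ.filter fun x => x ≠ b ∧ (x = a ∨ G.Adj x a),
    Finset.univ.filter fun x => x ≠ b ∧ ¬ (x = a ∨ G.Adj x a), by simp, by simp, ?_, ?_, ?_⟩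
  · rw [Finset.disjoint_filter]
    tauto
  · intro x
    simp only [Finset.mem_filter, Finset.mem_univ, true_and]
    tauto
  · -- an edge between the two parts contradicts transitivity of adjacency off `b`
    have hcross : ∀ x y, x ≠ b → (x = a ∨ G.Adj x a) → y ≠ b → ¬ (y = a ∨ G.Adj y a) →
        ¬ G.Adj x y := by
      rintro x y hx hxa hy hya hadj
      push Not at hya
      rcases hxa with rfl | hxa
      · exact hya.2 hadj.symm
      · exact hya.2 (htrans y x a hy hx hab' hya.1 hadj.symm hxa)
    intro x y
    simp only [Finset.mem_filter, Finset.mem_univ, true_and]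
    constructor
    · intro h
      exact ⟨h.ne, fun h' => hcross x y h'.1.1 h'.1.2 h'.2.1 h'.2.2 h,
        fun h' => hcross y x h'.2.1 h'.2.2 h'.1.1 h'.1.2 h.symm⟩
    · rintro ⟨hxy, h1, h2⟩
      by_cases hxb : x = b
      · subst hxb
        exact hb y hxy.symm
      by_cases hyb : y = b
      · subst hyb
        exact (hb x hxy).symm
      by_cases hxa : x = a ∨ G.Adj x a
      · have hya : y = a ∨ G.Adj y a := by
          by_contra hya
          exact h1 ⟨⟨hxb, hxa⟩, hyb, hya⟩
        rcases hxa with rfl | hxa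
        · exact (hya.resolve_left hxy.symm).symm
        · rcases hya with rfl | hya
          · exact hxa
          · exact htrans x a y hxb hab' hyb hxy hxa hya.symm
      · have hya : ¬ (y = a ∨ G.Adj y a) := fun hya => h2 ⟨⟨hxb, hxa⟩, hyb, hya⟩
        push Not at hxa hya
        by_contra hn
        exact hle.not_claw (hb x hxb) (hb y hyb) hab.symm hxy hxa.1 hya.1 hn hxa.2 hya.2

end Diameter

/-! ### Diameter at least three -/

section LargeDiameter

theorem exists_isPendantClique (C : Set V) (hclique : ∀ x ∈ C, ∀ y ∈ C, x ≠ y → G.Adj x y)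
    (hpend : ∀ x ∉ C, ∃ y ∈ C, ∀ z, G.Adj x z ↔ z = y)
    (huniq : ∀ y ∈ C, ∀ x ∉ C, ∀ x' ∉ C, G.Adj x y → G.Adj x' y → x = x') :
    ∃ p, IsPendantClique G p ∧ ∀ x, p x = x ↔ x ∈ C := by
  classical
  choose! n hn hadj using hpend
  set p : V → V := fun x => if x ∈ C then x else n x with hp
  have hpC : ∀ x ∈ C, p x = x := fun x hx => by simp [hp, hx]
  have hpn : ∀ x ∉ C, p x = n x := fun x hx => by simp [hp, hx]
  have hfix : ∀ x, p x = x ↔ x ∈ C := by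
    intro x
    refine ⟨fun h => ?_, hpC x⟩
    by_contra hx
    rw [hpn x hx] at h
    have := hn x hx
    rw [h] at this
    exact hx this
  refine ⟨p, ⟨fun x => ?_, fun x y h => ?_, fun x y => ?_⟩, hfix⟩
  · by_cases hx : x ∈ C
    · rw [hpC x hx, hpC x hx]
    · rw [hpn x hx, hpC _ (hn x hx)]
  · by_cases hx : x ∈ C
    · exact .inr (.inl (hpC x hx))
    by_cases hy : y ∈ C
    · exact .inr (.inr (hpC y hy))
    rw [hpn x hx, hpn y hy] at h
    exact .inl (huniq _ (hn x hx) x hx y hy ((hadj x hx _).mpr rfl) ((hadj y hy _).mpr h))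
  · rw [hfix, hfix]
    by_cases hx : x ∈ C <;> by_cases hy : y ∈ C
    · rw [hpC x hx, hpC y hy]
      exact ⟨fun h => ⟨h.ne, .inr ⟨hx, hy⟩⟩, fun h => hclique x hx y hy h.1⟩
    · rw [hpC x hx, hpn y hy, G.adj_comm, hadj y hy]
      refine ⟨fun h => ⟨?_, .inl h⟩, fun h => ?_⟩
      · rintro rfl
        exact hy hx
      · tauto
    · rw [hpn x hx, hpC y hy, hadj x hx]
      refine ⟨fun h => ⟨?_, .inl h.symm⟩, fun h => ?_⟩
      · rintro rfl
        exact hx hy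
      · have := h.2
        tauto
    · rw [hpn x hx, hpn y hy, hadj x hx]
      refine ⟨fun h => ?_, fun h => ?_⟩
      · rw [h] at hy
        exact absurd (hn x hx) hy
      · have h3 := h.2.resolve_right fun h' => hx h'.1
        exact absurd (huniq _ (hn x hx) x hx y hy ((hadj x hx _).mpr rfl)
          ((hadj y hy _).mpr h3)) h.1

theorem IsGeodesic.reverse {a b c d : V} (h : IsGeodesic G ![a, b, c, d]) :
    IsGeodesic G ![d, c, b, a] := by
  have h01 : G.dist a b = 1 := h 0 1 (by decide)
  have h02 : G.dist a c = 2 := h 0 2 (by decide)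
  have h03 : G.dist a d = 3 := h 0 3 (by decide)
  have h12 : G.dist b c = 1 := h 1 2 (by decide)
  have h13 : G.dist b d = 2 := h 1 3 (by decide)
  have h23 : G.dist c d = 1 := h 2 3 (by decide)
  apply isGeodesic_of_dist <;> rw [G.dist_comm] <;> assumption

variable [Fintype V]

theorem IsGeodesic.dist_eq_of_ne {a b c d : V} (h : IsGeodesic G ![a, b, c, d])
    (hle : QecLE G (-(2 - √2))) {x : V} (ha : x ≠ a) (hb : x ≠ b) (hc : x ≠ c) (hd : x ≠ d) :
    G.dist x a = G.dist x d ∧ G.dist x b = G.dist x c :=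
  h.dist_eq_dist hle (x := x) (by
    intro i
    fin_cases i <;> simp [ha.symm, hb.symm, hc.symm, hd.symm])

/-- The end of a geodesic of length three is a pendant vertex. -/
theorem IsGeodesic.adj_iff {a b c d : V} (h : IsGeodesic G ![a, b, c, d])
    (hle : QecLE G (-(2 - √2))) (hG : G.Connected) (z : V) : G.Adj a z ↔ z = b := by
  have hab : G.dist a b = 1 := h 0 1 (by decide)
  have hac : G.dist a c = 2 := h 0 2 (by decide)
  have had : G.dist a d = 3 := h 0 3 (by decide)
  refine ⟨fun haz => ?_, ?_⟩
  · by_contra hzb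
    have h1 := SimpleGraph.dist_eq_one_iff_adj.mpr haz
    have h2 : z ≠ c := by rintro rfl; omega
    have h3 : z ≠ d := by rintro rfl; omega
    have h4 := (h.dist_eq_of_ne hle haz.ne.symm hzb h2 h3).1
    have h5 := hG.dist_triangle (u := a) (v := z) (w := d)
    rw [G.dist_comm] at h1
    rw [G.dist_comm (u := a) (v := z)] at h5
    omega
  · rintro rfl
    exact SimpleGraph.dist_eq_one_iff_adj.mp hab

/-- If some two vertices have distance at least three, then `G` is a complete graph with pendant
vertices. The complete graph consists of the two middle vertices of a geodesic of length three and
of their common neighbours. -/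
theorem IsGeodesic.exists_isPendantClique {a b c d : V} (h : IsGeodesic G ![a, b, c, d])
    (hle : QecLE G (-(2 - √2))) (hG : G.Connected) :
    ∃ p, IsPendantClique G p ∧ p a ≠ a ∧ p d ≠ d ∧ a ≠ d := by
  have hab : G.dist a b = 1 := h 0 1 (by decide)
  have hac : G.dist a c = 2 := h 0 2 (by decide)
  have had : G.dist a d = 3 := h 0 3 (by decide)
  have hbc : G.dist b c = 1 := h 1 2 (by decide)
  have hbd : G.dist b d = 2 := h 1 3 (by decide)
  have hcd : G.dist c d = 1 := h 2 3 (by decide)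
  have hbc' := SimpleGraph.dist_eq_one_iff_adj.mp hbc
  have hne_ab : a ≠ b := by rintro rfl; simp at hab
  have hne_ac : a ≠ c := by rintro rfl; simp at hac
  have hne_ad : a ≠ d := by rintro rfl; simp at had
  have hne_bd : b ≠ d := by rintro rfl; simp at hbd
  have hne_cd : c ≠ d := by rintro rfl; simp at hcd
  have hNa := h.adj_iff hle hG
  have hNd := h.reverse.adj_iff hle hG
  set C : Set V := {x | x = b ∨ x = c ∨ G.Adj x b ∧ G.Adj x c} with hC
  have hbC : b ∈ C := .inl rfl
  have hcC : c ∈ C := .inr (.inl rfl)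
  have haC : a ∉ C := by
    rintro (h' | h' | h')
    · exact hne_ab h'
    · exact hne_ac h'
    · exact hbc'.ne ((hNa c).mp h'.2).symm
  have hdC : d ∉ C := by
    rintro (h' | h' | h')
    · exact hne_bd h'.symm
    · exact hne_cd h'.symm
    · exact hbc'.ne ((hNd b).mp h'.1)
  have hsymm : ∀ x, x ≠ a → x ∉ C → x ≠ d → G.dist x b = G.dist x c := by
    intro x hxa hxC hxd
    exact (h.dist_eq_of_ne hle hxa (fun h' => hxC (.inl h')) (fun h' => hxC (.inr (.inl h')))
      hxd).2
  -- outside of the path, the only vertices adjacent to `b` or `c` are those of `C`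
  have hnb : ∀ x, x ≠ a → x ∉ C → ¬ G.Adj b x := by
    intro x hxa hxC hadj
    have hxd : x ≠ d := by
      rintro rfl
      exact hbc'.ne ((hNd b).mp hadj.symm)
    have h1 := hsymm x hxa hxC hxd
    rw [SimpleGraph.dist_eq_one_iff_adj.mpr hadj.symm] at h1
    exact hxC (.inr (.inr ⟨hadj.symm, SimpleGraph.dist_eq_one_iff_adj.mp h1.symm⟩))
  have hnc : ∀ x, x ≠ d → x ∉ C → ¬ G.Adj c x := by
    intro x hxd hxC hadj
    have hxa : x ≠ a := by
      rintro rfl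
      exact hbc'.ne ((hNa c).mp hadj.symm).symm
    have h1 := hsymm x hxa hxC hxd
    rw [SimpleGraph.dist_eq_one_iff_adj.mpr hadj.symm] at h1
    exact hxC (.inr (.inr ⟨SimpleGraph.dist_eq_one_iff_adj.mp h1, hadj.symm⟩))
  have hgeo : ∀ y x, G.Adj y b → G.Adj y c → x ∉ C → G.Adj y x → IsGeodesic G ![a, b, y, x] := by
    intro y x hyb hyc hxC hyx
    have hya : y ≠ a := by
      rintro rfl
      exact haC (.inr (.inr ⟨hyb, hyc⟩))
    have hxa : x ≠ a := by
      rintro rfl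
      exact hyb.ne ((hNa y).mp hyx.symm)
    have hxb : b ≠ x := fun h' => hxC (.inl h'.symm)
    have hbx := SimpleGraph.dist_eq_two_of_adj hxb (hnb x hxa hxC) hyb.symm hyx
    have hay := SimpleGraph.dist_eq_two_of_adj hya.symm
      (fun h' => hyb.ne ((hNa y).mp h')) ((hNa b).mpr rfl) hyb.symm
    obtain ⟨z, haz, hz⟩ := hG.exists_adj_dist_succ hxa.symm
    rw [(hNa z).mp haz, hbx] at hz
    exact isGeodesic_of_dist hab hay hz.symm (SimpleGraph.dist_eq_one_iff_adj.mpr hyb.symm) hbx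
      (SimpleGraph.dist_eq_one_iff_adj.mpr hyx)
  -- a vertex at distance two from `b` lies next to a common neighbour of `b` and `c`
  have hlayer : ∀ x, x ≠ d → x ∉ C → G.dist b x = 2 →
      ∃ y, G.Adj y b ∧ G.Adj y c ∧ G.Adj y x := by
    intro x hxd hxC hx
    obtain ⟨y, hby, hyx⟩ := hG.exists_adj_adj_of_dist_eq_two hx
    have hya : y ≠ a := by
      rintro rfl
      rw [(hNa x).mp hyx] at hx
      simp at hx
    have hyC : y ∈ C := by
      by_contra hyC
      exact hnb y hya hyC hby
    rcases hyC with rfl | rfl | hy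
    · exact absurd rfl hby.ne
    · exact absurd hyx (hnc x hxd hxC)
    · exact ⟨y, hy.1, hy.2, hyx⟩
  have htwo : ∀ x, G.dist b x ≤ 2 := by
    intro x
    by_contra! hlt
    rw [G.dist_comm] at hlt
    obtain ⟨x, hx⟩ := hG.exists_dist_eq (n := 3) hlt
    have hxb : x ≠ b := by rintro rfl; simp at hx
    obtain ⟨u, hxu, hu⟩ := hG.exists_adj_dist_succ hxb
    have hu2 : G.dist b u = 2 := by rw [G.dist_comm]; omega
    have hud : u ≠ d := by
      rintro rfl
      rw [(hNd x).mp hxu.symm, G.dist_comm] at hx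
      omega
    have huC : u ∉ C := by
      rintro (h' | h' | h')
      · rw [h'] at hu2; simp at hu2
      · rw [h'] at hu2; omega
      · have := SimpleGraph.dist_eq_one_iff_adj.mpr h'.1
        rw [G.dist_comm] at this
        omega
    obtain ⟨y, hyb, hyc, hyu⟩ := hlayer u hud huC hu2
    have hxy := ((hgeo y u hyb hyc huC hyu).reverse.adj_iff hle hG x).mp hxu.symm
    rw [hxy, SimpleGraph.dist_eq_one_iff_adj.mpr hyb] at hx
    omega
  obtain ⟨p, hp, hfix⟩ := QEGraph.exists_isPendantClique (G := G) C (by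
    rintro x (rfl | rfl | hx) y (rfl | rfl | hy) hxy
    · exact absurd rfl hxy
    · exact hbc'
    · exact hy.1.symm
    · exact hbc'.symm
    · exact absurd rfl hxy
    · exact hy.2.symm
    · exact hx.1
    · exact hx.2
    · exact hle.adj_of_adj hbc' hx.1.symm hx.2.symm hy.1.symm hy.2.symm hxy) (by
    intro x hxC
    by_cases hxa : x = a
    · subst hxa
      exact ⟨b, hbC, hNa⟩
    by_cases hxd : x = d
    · subst hxd
      exact ⟨c, hcC, hNd⟩
    have hx2 : G.dist b x = 2 := by
      have h0 : b ≠ x := fun h' => hxC (.inl h'.symm)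
      have h1 := hG.pos_dist_of_ne h0
      have h2 : G.dist b x ≠ 1 := fun h' =>
        hnb x hxa hxC (SimpleGraph.dist_eq_one_iff_adj.mp h')
      have := htwo x
      omega
    obtain ⟨y, hyb, hyc, hyx⟩ := hlayer x hxd hxC hx2
    exact ⟨y, .inr (.inr ⟨hyb, hyc⟩), (hgeo y x hyb hyc hxC hyx).reverse.adj_iff hle hG⟩) (by
    rintro y (rfl | rfl | hy) x hxC x' hxC' hxy hxy'
    · have h1 : x = a := by
        by_contra h'
        exact hnb x h' hxC hxy.symm
      have h2 : x' = a := by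
        by_contra h'
        exact hnb x' h' hxC' hxy'.symm
      rw [h1, h2]
    · have h1 : x = d := by
        by_contra h'
        exact hnc x h' hxC hxy.symm
      have h2 : x' = d := by
        by_contra h'
        exact hnc x' h' hxC' hxy'.symm
      rw [h1, h2]
    · by_contra hne
      have hg := hgeo y x hy.1 hy.2 hxC hxy.symm
      have hxa : x' ≠ a := by
        rintro rfl
        exact hy.1.ne ((hNa y).mp hxy')
      have hxb : x' ≠ b := fun h' => hxC' (.inl h')
      have h1 := (hg.dist_eq_of_ne hle hxa hxb hxy'.ne (Ne.symm hne)).2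
      rw [SimpleGraph.dist_eq_one_iff_adj.mpr hxy'] at h1
      exact hnb x' hxa hxC' (SimpleGraph.dist_eq_one_iff_adj.mp h1).symm)
  exact ⟨p, hp, fun h' => haC ((hfix a).mp h'), fun h' => hdC ((hfix d).mp h'), hne_ad⟩

end LargeDiameter

end Classification

/-! ### Isomorphisms with the star products -/

section Isomorphism

theorem _root_.SimpleGraph.Iso.dist_eq {V W : Type*} {G : SimpleGraph V} {H : SimpleGraph W}
    (e : G ≃g H) (hG : G.Connected) (x y : V) : H.dist (e x) (e y) = G.dist x y := by
  have hH : H.Connected := e.connected_iff.mp hG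
  apply le_antisymm
  · obtain ⟨w, hw⟩ := hG.exists_walk_length_eq_dist x y
    rw [← hw, ← SimpleGraph.Walk.length_map e.toHom w]
    exact SimpleGraph.dist_le _
  · obtain ⟨w, hw⟩ := hH.exists_walk_length_eq_dist (e x) (e y)
    have h := SimpleGraph.dist_le (w.map e.symm.toHom)
    rw [SimpleGraph.Walk.length_map, hw] at h
    simpa using h

theorem qec_congr {V W : Type*} [Fintype V] [Fintype W] [Nontrivial V] {G : SimpleGraph V}
    {H : SimpleGraph W} (e : G ≃g H) (hG : G.Connected) : qec G = qec H := by
  have : Nontrivial W := e.toEquiv.symm.nontrivial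
  obtain ⟨hle, f, hf, hf0, hfe⟩ := (qec_eq_iff H _).mp rfl
  have hsum : ∀ φ : W → ℝ, ∑ x, φ (e x) = ∑ y, φ y := fun φ => Equiv.sum_comp e.toEquiv φ
  have hform : ∀ f : W → ℝ, distForm G (fun x => f (e x)) (fun x => f (e x)) = distForm H f f := by
    intro f
    unfold distForm
    rw [← hsum]
    refine Finset.sum_congr rfl fun x _ => ?_
    rw [← hsum]
    refine Finset.sum_congr rfl fun y _ => ?_
    rw [e.dist_eq hG]
  refine (qec_eq_iff G _).mpr ⟨fun g hg => ?_, fun x => f (e x), by rw [hsum f, hf],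
    fun h0 => hf0 ?_, ?_⟩
  · have h1 : (fun x => (fun y => g (e.symm y)) (e x)) = g := by
      funext x
      simp
    have h2 := hle (fun y => g (e.symm y)) (by rw [← hsum]; simpa using hg)
    rw [← hform, ← hsum, h1] at h2
    simpa using h2
  · funext y
    simpa using congrFun h0 (e.symm y)
  · rw [hform, hfe, hsum fun y => f y ^ 2]

/-- Two colourings with colour classes of equal size differ by a bijection of the vertices. -/
theorem exists_equiv_of_card_fiber_eq {V W T : Type*} [Fintype V] [Fintype W] [DecidableEq T]
    (κ : V → T) (κ' : W → T)
    (h : ∀ t, (Finset.univ.filter fun x => κ x = t).card =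
      (Finset.univ.filter fun y => κ' y = t).card) :
    ∃ e : V ≃ W, ∀ x, κ' (e x) = κ x := by
  have hf : ∀ t, Nonempty ({x // κ x = t} ≃ {y // κ' y = t}) := fun t =>
    Fintype.card_eq.mp (by rw [Fintype.card_subtype, Fintype.card_subtype, h t])
  let φ := fun t => (hf t).some
  refine ⟨(Equiv.sigmaFiberEquiv κ).symm.trans
    ((Equiv.sigmaCongrRight φ).trans (Equiv.sigmaFiberEquiv κ')), fun x => ?_⟩
  exact (φ (κ x) ⟨x, rfl⟩).2

namespace IsCliquePair

theorem nonempty_iso {V W : Type*} [Fintype V] [Fintype W] {G : SimpleGraph V}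
    {H : SimpleGraph W} {b : V} {A C : Finset V} {b' : W} {A' C' : Finset W}
    (h : IsCliquePair G b A C) (h' : IsCliquePair H b' A' C') (hA : A.card = A'.card)
    (hC : C.card = C'.card) : Nonempty (G ≃g H) := by
  classical
  have hd : ∀ x, x ∈ C → x ∉ A := fun x hx => Finset.disjoint_right.mp h.disjoint hx
  have hd' : ∀ x, x ∈ C' → x ∉ A' := fun x hx => Finset.disjoint_right.mp h'.disjoint hx
  obtain ⟨e, he⟩ := exists_equiv_of_card_fiber_eq
    (fun x : V => if x ∈ A then (0 : Fin 3) else if x ∈ C then 1 else 2)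
    (fun y : W => if y ∈ A' then (0 : Fin 3) else if y ∈ C' then 1 else 2) (by
      intro t
      fin_cases t
      · convert hA using 2 <;> ext x <;> simp <;> grind
      · convert hC using 2 <;> ext x <;> simp <;> grind
      · refine (Finset.card_eq_one.mpr ⟨b, ?_⟩).trans (Finset.card_eq_one.mpr ⟨b', ?_⟩).symm
        · ext x
          have := h.cover x
          have := h.notMem_left
          have := h.notMem_right
          simp
          grind
        · ext x
          have := h'.cover x
          have := h'.notMem_left
          have := h'.notMem_right
          simp
          grind)
  have hmA : ∀ x, e x ∈ A' ↔ x ∈ A := by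
    intro x
    have := he x
    grind
  have hmC : ∀ x, e x ∈ C' ↔ x ∈ C := by
    intro x
    have := he x
    grind
  exact ⟨⟨e, fun {x y} => by rw [h.adj_iff, h'.adj_iff]; simp [hmA, hmC]⟩⟩

end IsCliquePair

theorem isCliquePair_completeStarTwo :
    IsCliquePair (completeStarTwo 4 3) (.inl 0)
      (Finset.univ.filter fun x => x.isLeft ∧ x ≠ .inl 0)
      (Finset.univ.filter fun x => x.isRight) where
  notMem_left := by simp
  notMem_right := by simp
  disjoint := by
    rw [Finset.disjoint_filter]
    rintro (x | x) <;> simp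
  cover := by
    rintro (x | x) <;> simp [em]
  adj_iff := by
    rintro (x | ⟨i, x⟩) (y | ⟨j, y⟩)
    · simp [completeStarTwo, starProduct, starAdj]
    · simp [completeStarTwo, starProduct, starAdj, y.2.symm]
    · simp [completeStarTwo, starProduct, starAdj, x.2.symm]
    · simp [completeStarTwo, starProduct, starAdj, Subtype.ext_iff]
      exact ⟨fun h => h.2.2, fun h => ⟨y.2, x.2, h⟩⟩

theorem eq_one_of_pendant (x : {w : Fin 2 // w ≠ 0}) : x = ⟨1, by decide⟩ :=
  Subtype.ext (Fin.eq_one_of_ne_zero x.1 x.2)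

theorem isPendantClique_completeStar {n s : ℕ} (hsn : s ≤ n) :
    IsPendantClique (completeStar n hsn fun _ => 2)
      (Sum.elim Sum.inl fun x => Sum.inl (Fin.castLE hsn x.1)) where
  idem := by rintro (x | x) <;> rfl
  fiber := by
    rintro (x | ⟨i, x⟩) (y | ⟨j, y⟩) <;> simp
    exact fun h => ⟨h, (eq_one_of_pendant x).trans (eq_one_of_pendant y).symm⟩
  adj_iff := by
    rintro (x | ⟨i, x⟩) (y | ⟨j, y⟩)
    · simp [completeStar, starProduct, starAdj]
    · simp [completeStar, starProduct, starAdj, y.2.symm]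
    · simp [completeStar, starProduct, starAdj, x.2.symm]
      exact eq_comm
    · rw [eq_one_of_pendant x, eq_one_of_pendant y]
      simp [completeStar, starProduct, starAdj]

theorem IsPendantClique.exists_iso {V : Type*} [Fintype V] {G : SimpleGraph V} {p : V → V}
    (h : IsPendantClique G p) {x y : V} (hx : p x ≠ x) (hy : p y ≠ y) (hxy : x ≠ y) :
    ∃ (n s : ℕ) (hsn : s ≤ n), 2 ≤ s ∧ Nonempty (G ≃g completeStar n hsn fun _ => 2) := by
  classical
  set n := Fintype.card {x // p x = x} with hn
  set s := Fintype.card {x // ¬ p x = x} with hs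
  have hinj : Function.Injective
      (fun w : {x // ¬ p x = x} => (⟨p w, h.idem w⟩ : {x // p x = x})) := by
    intro u w huw
    have := h.fiber u w (congrArg Subtype.val huw)
    exact Subtype.ext ((this.resolve_right fun h' => h'.elim u.2 w.2))
  have hsn : s ≤ n := Fintype.card_le_of_injective _ hinj
  have h2s : 2 ≤ s := Fintype.one_lt_card_iff.mpr
    ⟨⟨x, hx⟩, ⟨y, hy⟩, fun h' => hxy (congrArg Subtype.val h')⟩
  let eW : Fin s ≃ {x // ¬ p x = x} := (Fintype.equivFin _).symm
  let eC₀ : Fin n ≃ {x // p x = x} := (Fintype.equivFin _).symm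
  -- permute the vertices of the complete graph so that the pendant vertices sit at the first ones
  obtain ⟨g, hg⟩ := Equiv.Perm.exists_extending_pair (Fin.castLE hsn)
    (fun i => eC₀.symm ⟨p (eW i), h.idem _⟩) (Fin.castLE_injective hsn)
    (eC₀.symm.injective.comp (hinj.comp eW.injective))
  have hg' : ∀ i : Fin s, ((eC₀ (g (Fin.castLE hsn i))) : V) = p (eW i) := by
    intro i
    rw [hg i, Equiv.apply_symm_apply]
  let eP : (Σ _ : Fin s, {w : Fin 2 // w ≠ 0}) ≃ Fin s :=
    { toFun := fun x => x.1
      invFun := fun i => ⟨i, 1, by decide⟩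
      left_inv := by
        rintro ⟨i, w, hw⟩
        obtain rfl : w = 1 := Fin.eq_one_of_ne_zero w hw
        rfl
      right_inv := fun i => rfl }
  let e := (Equiv.sumCongr (g.trans eC₀) (eP.trans eW)).trans (Equiv.sumCompl fun x => p x = x)
  have hl : ∀ i, e (.inl i) = eC₀ (g i) := fun i => rfl
  have hr : ∀ i, e (.inr i) = eW i.1 := fun i => rfl
  refine ⟨n, s, hsn, h2s, ⟨RelIso.symm ⟨e, fun {u v} => ?_⟩⟩⟩
  have hpe : ∀ u, p (e u) = e (Sum.elim Sum.inl (fun x => Sum.inl (Fin.castLE hsn x.1)) u) := by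
    rintro (i | i)
    · exact (eC₀ (g i)).2
    · exact (hg' i.1).symm
  rw [h.adj_iff, (isPendantClique_completeStar hsn).adj_iff]
  simp only [hpe, e.injective.eq_iff, ne_eq]

end Isomorphism

end QEGraph

theorem mainTheorem4 {V : Type*} [Fintype V] [Nontrivial V] (G : SimpleGraph V)
    (hG : G.Connected) :
    QEGraph.qec (SimpleGraph.pathGraph 4) = -(2 - √2) ∧
    (QEGraph.qec G = QEGraph.qec (SimpleGraph.pathGraph 4) ↔
      Nonempty (G ≃g QEGraph.completeStarTwo 4 3) ∨
      ∃ (n s : ℕ) (hsn : s ≤ n), 2 ≤ s ∧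
        Nonempty (G ≃g QEGraph.completeStar n hsn (fun _ => 2))) := by
  open QEGraph in
  refine ⟨qec_pathGraph_four, ?_⟩
  rw [qec_pathGraph_four]
  have hA : (Finset.univ.filter fun x : Fin 4 ⊕ (Σ _ : Unit, {w : Fin 3 // w ≠ 0}) =>
      x.isLeft ∧ x ≠ .inl 0).card = 3 := by decide
  have hC : (Finset.univ.filter fun x : Fin 4 ⊕ (Σ _ : Unit, {w : Fin 3 // w ≠ 0}) =>
      x.isRight).card = 2 := by decide
  constructor
  · intro hq
    have hle := ((qec_eq_iff G _).mp hq).1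
    by_cases hdiam : ∀ x y, G.dist x y ≤ 2
    · left
      obtain ⟨b, A, C, h⟩ := hle.exists_isCliquePair hG hdiam
      have hcard := h.card_mul_card_of_qec_eq hq
      have hK := isCliquePair_completeStarTwo
      -- `(|A| - 1) (|C| - 1) = 2` has only the solutions `{2, 3}`
      have hsol : (A.card = 3 ∧ C.card = 2) ∨ (A.card = 2 ∧ C.card = 3) := by
        generalize A.card = α at hcard
        generalize C.card = γ at hcard
        have h1 : α ≤ 3 := by
          by_contra! h1
          rcases Nat.lt_or_ge γ 2 with h2 | h2
          · interval_cases γ <;> omega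
          · nlinarith
        interval_cases α <;> omega
      rcases hsol with ⟨h1, h2⟩ | ⟨h1, h2⟩
      · exact h.nonempty_iso hK (h1.trans hA.symm) (h2.trans hC.symm)
      · exact h.swap.nonempty_iso hK (h2.trans hA.symm) (h1.trans hC.symm)
    · right
      push Not at hdiam
      obtain ⟨x, y, hxy⟩ := hdiam
      obtain ⟨a, b, c, d, hg⟩ := hG.exists_isGeodesic hxy
      obtain ⟨p, hp, ha, hd, had⟩ := hg.exists_isPendantClique hle hG
      exact hp.exists_iso ha hd had
  · rintro (⟨⟨e⟩⟩ | ⟨n, s, hsn, h2, ⟨e⟩⟩)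
    · have := e.toEquiv.symm.nontrivial
      rw [qec_congr e hG]
      exact isCliquePair_completeStarTwo.qec_eq_of_card hA hC
    · have := e.toEquiv.symm.nontrivial
      rw [qec_congr e hG]
      refine (isPendantClique_completeStar hsn).qec_eq (x := .inr ⟨⟨0, by omega⟩, 1, by decide⟩)
        (y := .inr ⟨⟨1, by omega⟩, 1, by decide⟩) ?_ ?_ ?_ <;> simp
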